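/- **The model.** The 1D3P lattice gas lives on $\mathbb Z$; each site has three bits $B=\{-,0,+\}$ with velocities $c_-=-1,\ c_0=0,\ c_+=1$. Write $\widehat{i}=B\setminus\{i\}$ for the three two‑element subsets of $B$. In a collision, a two‑particle state goes to each of the other two two‑particle states with probability $p$ (and stays put with probability $1-2p$), and every other state is unchanged; $A(s\to s')$ denotes this transition probability. With mean vertex coefficients $V^\mu{}_\nu=\sum_{s'\supseteq\mu}\sum_{s\subseteq\nu}(-1)^{|\nu|-|s|}A(s\to s')$, the correlation vertex coefficients at mean occupation $f$ of each bit are $$\mathcal V^\alpha{}_\beta=\sum_{\mu\subseteq\alpha,\ \nu\supseteq\beta}(-f)^{|\alpha\setminus\mu|}f^{|\nu\setminus\beta|}V^\mu{}_\nu .$$ The Jacobian is $J^i{}_j=\mathcal V^i{}_j-\delta^i{}_j$, and $q^2=(-1,0,1)$ is an eigenvector of $J$ with eigenvalue $\lambda^2=-3pf$. Let $g=fp$, $0<p\le\frac12$, $0<f<1$. **Diagrams.** Two virtual particles leave the origin in the directions $\widehat{b}$ and later arrive together at one site in the directions $\widehat{a}$. Between these events they pass through $n$ time steps of internal vertices,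 and after every vertex each particle moves along its lattice vector. Let $Y_n$ be the matrix whose entry $(a,b)$ is the sum of the weights of all such diagrams. * *2‑particle BBGKY approximation*: at each time step exactly two bits are occupied, and the weight is the product of $\mathcal V^{\alpha_x}{}_{\beta_x}$ over all vertices $x$, where $\beta_x$ and $\alpha_x$ are the incoming and outgoing sets. * *Ring approximation*: the two virtual particles propagate independently, each with the one‑to‑one coefficients $\mathcal V^i{}_j$. If $y^i{}_k(x,t)$ is the factor of one particle, with $y^i{}_k(x,1)=\delta_{ik}\delta_{x,c_k}$ and $y^i{}_k(x+c_i,t+1)=\sum_j\mathcal V^i{}_j\,y^j{}_k(x,t)$, then the weight from $\{k,l\}$ to $\{i,j\}$ at time $t=n+1$ is $\sum_x\big(y^i{}_k y^j{}_l+y^i{}_l y^j{}_k\big)(x,t)$. In either approximation the renormalized Jacobian truncated at length $\tau$ is $J^i{}_j+\sum_{n<\tau}\sum_{a,b}\mathcal V^i{}_{\widehat a}\,(Y_n)_{ab}\,\mathcal V^{\widehat b}{}_j$. The *shift* $\delta\lambda^2$ is the limit as $\tau\to\infty$ of its eigenvalue on $q^2$ minus $\lambda^2$. **The matrices $M$ and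 $\mathcal U$.** $M$ is the sum, over all $n$, of the two‑particle diagrams in which the particles sit at distinct sites at all internal time steps. The effective collision matrix $\mathcal U$ of the ring approximation has as entry $(a,b)$ the total amplitude for an incoming pair $\widehat b$ at a vertex to separate in the directions $\widehat a$, at that vertex or after moving together in common directions for any number of steps, each particle carrying the one‑to‑one coefficients. **Theorem.** 1. The sums defining $\mathcal U$ converge, with $$\mathcal U_{ab}=\delta_{ab}\Big[1-9g\,\tfrac{3g-2}{3g-4}\Big]+3g\,\tfrac{3g-2}{3g-4},\qquad q^2\,\mathcal U=w\,q^2,\quad w=1-9g\,\tfrac{3g-2}{3g-4}.$$ The two‑particle collision matrix $(\mathcal V^{\widehat a}{}_{\widehat b})$ satisfies $q^2\mathcal V=v\,q^2$ with $v=1-3p+3pf$. 2. The sums defining $M$ converge, and $q^2$ is a left and right eigenvector of $M$ with an eigenvalue $l$; moreover $|lw|<1$ and $|lv|<1$. 3. In both approximations $q^2$ is a left and right eigenvector of every truncated renormalized Jacobian, and the series for its eigenvalue shift, $\sum_n 9p^2f(1-f)\big[(Y_n)_{++}-(Y_n)_{-+}\big]$, converges absolutely. The ring shift $\delta$ and the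 2‑particle BBGKY shift $\delta'$ are the finite numbers $$\delta=\frac{9p^2f(1-f)\,l}{1-lw},\qquad \delta'=\frac{9p^2f(1-f)\,l}{1-lv}.$$ 4. They satisfy, with non‑zero denominators, $$\frac{\delta(4-3pf)}{\delta(4-21pf+27p^2f^2)+9p^2f(1-f)(4-3pf)}=\frac{\delta'}{\delta'(1-3p+3pf)+9p^2f(1-f)} .$$ -/

import Mathlib

open Finset
open scoped Matrix

noncomputable section

namespace OneD3P

/-! The three bits `-, 0, +` of a site are `0, 1, 2 : Fin 3`. States of a site and sets of
virtual particles (VPs) at a site are elements of `Finset (Fin 3)`. The lattice is `ℤ`. -/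

/-- The lattice velocity of a bit: `-1, 0, 1` for `-, 0, +`. -/
def velocity (i : Fin 3) : ℤ := (i : ℤ) - 1

/-- The two-element set of bits denoted by a circumflex: all bits other than `i`. -/
def hat (i : Fin 3) : Finset (Fin 3) := univ.erase i

theorem hat_eq (i : Fin 3) : hat i = {i + 1, i + 2} := by
  revert i; decide

/-- The ensemble-averaged transition probability from state `s` to state `s'`: a two-particle state
moves to each of the two other two-particle states with probability `p`; all other states are
left alone. -/
def transition (p : ℝ) (s s' : Finset (Fin 3)) : ℝ :=
  if s.card = 2 ∧ s'.card = 2 then (if s = s' then 1 - 2 * p else p)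
  else if s = s' then 1 else 0

/-- The mean vertex coefficient with outgoing set `μ` and incoming set `ν`. -/
def meanVertex (p : ℝ) (μ ν : Finset (Fin 3)) : ℝ :=
  ∑ s' ∈ univ.filter (fun s' => μ ⊆ s'), ∑ s ∈ ν.powerset,
    (-1) ^ (ν.card - s.card) * transition p s s'

/-- The correlation vertex coefficient with outgoing set `α` and incoming set `β`, at the
equilibrium in which every bit has mean occupation `f`. -/
def cvc (p f : ℝ) (α β : Finset (Fin 3)) : ℝ :=
  ∑ μ ∈ α.powerset, ∑ ν ∈ univ.filter (fun ν => β ⊆ ν),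
    (-1) ^ (α \ μ).card * f ^ (α \ μ).card * f ^ (ν \ β).card * meanVertex p μ ν

/-- The vertex coefficients with one outgoing and one incoming VP. -/
def vertex11 (p f : ℝ) : Matrix (Fin 3) (Fin 3) ℝ := .of fun i j => cvc p f {i} {j}

/-- The vertex coefficients with one outgoing VP `i` and the incoming pair `hat b`. -/
def vertex12 (p f : ℝ) : Matrix (Fin 3) (Fin 3) ℝ := .of fun i b => cvc p f {i} (hat b)

/-- The vertex coefficients with the outgoing pair `hat a` and one incoming VP `j`. -/
def vertex21 (p f : ℝ) : Matrix (Fin 3) (Fin 3) ℝ := .of fun a j => cvc p f (hat a) {j}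

/-- The vertex coefficients with the outgoing pair `hat a` and the incoming pair `hat b`. -/
def vertex22 (p f : ℝ) : Matrix (Fin 3) (Fin 3) ℝ := .of fun a b => cvc p f (hat a) (hat b)

/-- The Jacobian of the Boltzmann collision operator at equilibrium. -/
def jacobian (p f : ℝ) : Matrix (Fin 3) (Fin 3) ℝ := vertex11 p f - 1

/-! ### Diagrams with two virtual particles -/

/-- The sites occupied by a set of bits of the whole lattice. -/
def sites (α : Finset (ℤ × Fin 3)) : Finset ℤ := α.image Prod.fst

/-- The bits of `α` at the site `x`. -/
def atSite (α : Finset (ℤ × Fin 3)) (x : ℤ) : Finset (Fin 3) :=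
  univ.filter fun i => (x, i) ∈ α

/-- Advection: each VP moves along its lattice vector. Outgoing VPs become incoming VPs. -/
def advect (α : Finset (ℤ × Fin 3)) : Finset (ℤ × Fin 3) :=
  α.image fun a => (a.1 + velocity a.2, a.2)

open Classical in
/-- The sum of the weights of all diagrams that have exactly two VPs at every time step, start with
the incoming VPs `β`, pass through `n` further collision steps, and end with incoming VPs that
all sit at one site and occupy there the set of bits `μ`. The weight of a diagram is the product
of the correlation vertex coefficients over its vertices, and only diagrams whose incoming set
at each of the `n` collision steps satisfies `ok` are included.
(Outgoing VPs at a site without incoming VPs have vertex coefficient zero.) -/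
def twoVPSum (p f : ℝ) (ok : Finset (ℤ × Fin 3) → Prop) :
    ℕ → Finset (ℤ × Fin 3) → Finset (Fin 3) → ℝ
  | 0, β, μ => if ∃ x : ℤ, β = {x} ×ˢ μ then 1 else 0
  | n + 1, β, μ =>
      if ok β then
        ∑ α ∈ (sites β ×ˢ (univ : Finset (Fin 3))).powersetCard 2,
          (∏ x ∈ sites β, cvc p f (atSite α x) (atSite β x)) * twoVPSum p f ok n (advect α) μ
      else 0

/-- Entry `(a, b)`: the sum over all two-particle diagrams that leave an initial vertex with
outgoing VPs `hat b`, pass through `n` time steps of internal vertices, and enter a final vertex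
with incoming VPs `hat a`. -/
def bbgkyPair (p f : ℝ) (n : ℕ) : Matrix (Fin 3) (Fin 3) ℝ :=
  .of fun a b => twoVPSum p f (fun _ => True) n (advect ({0} ×ˢ hat b)) (hat a)

/-- As `bbgkyPair`, but restricted to the diagrams in which the two VPs are at distinct sites at
all internal time steps, so that all internal vertices have one incoming VP. -/
def firstMeeting (p f : ℝ) (n : ℕ) : Matrix (Fin 3) (Fin 3) ℝ :=
  .of fun a b =>
    twoVPSum p f (fun β => (sites β).card = 2) n (advect ({0} ×ˢ hat b)) (hat a)

/-- The matrix `M`: the sum of `firstMeeting` over all lengths. -/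
def matrixM (p f : ℝ) : Matrix (Fin 3) (Fin 3) ℝ :=
  .of fun a b => ∑' n, firstMeeting p f n a b

/-! ### The ring approximation -/

/-- The factor `y` of a single VP that leaves the origin in direction `k`, passes through `n`
internal one-to-one vertices and arrives at `x` in direction `i` (so the time is `n + 1`). -/
def vpFactor (p f : ℝ) : ℕ → Fin 3 → Fin 3 → ℤ → ℝ
  | 0, i, k, x => if i = k ∧ x = velocity k then 1 else 0
  | n + 1, i, k, x => ∑ j, cvc p f {i} {j} * vpFactor p f n j k (x - velocity i)

/-- Entry `(a, b)`: the ring diagrams with `n` internal time steps, i.e. two independent VPs leave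
the origin in the directions of `hat b` and arrive together at some site in the directions of
`hat a`. (For `n = 0` this vanishes; `vpFactor` vanishes for `|x| > n + 1`.) -/
def ringPair (p f : ℝ) (n : ℕ) : Matrix (Fin 3) (Fin 3) ℝ :=
  .of fun a b => ∑ x ∈ Icc (-((n : ℤ) + 1)) ((n : ℤ) + 1),
    (vpFactor p f n (a + 1) (b + 1) x * vpFactor p f n (a + 2) (b + 2) x
      + vpFactor p f n (a + 1) (b + 2) x * vpFactor p f n (a + 2) (b + 1) x)

/-- The amplitude for an incoming pair `hat b` to leave the same vertex independently in the
directions of `hat a`. -/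
def ringU (p f : ℝ) : Matrix (Fin 3) (Fin 3) ℝ :=
  .of fun a b =>
    cvc p f {a + 1} {b + 1} * cvc p f {a + 2} {b + 2}
      + cvc p f {a + 1} {b + 2} * cvc p f {a + 2} {b + 1}

/-- The amplitude for an incoming pair `hat b` to leave with both VPs in direction `k`. -/
def ringT (p f : ℝ) : Matrix (Fin 3) (Fin 3) ℝ :=
  .of fun k b => cvc p f {k} {b + 1} * cvc p f {k} {b + 2}

/-- The amplitude for two VPs both incoming in direction `k` to both leave in direction `k'`. -/
def ringTogether (p f : ℝ) : Matrix (Fin 3) (Fin 3) ℝ :=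
  .of fun k' k => cvc p f {k'} {k} * cvc p f {k'} {k}

/-- The amplitude for two VPs both incoming in direction `k` to leave in the directions of
`hat a`. -/
def ringSplit (p f : ℝ) : Matrix (Fin 3) (Fin 3) ℝ :=
  .of fun a k =>
    cvc p f {a + 1} {k} * cvc p f {a + 2} {k} + cvc p f {a + 1} {k} * cvc p f {a + 2} {k}

/-- The amplitude for an incoming pair `hat b` to leave in a common direction, to stay together at
`n` further vertices, and then to separate in the directions of `hat a`. -/
def ringDelayed (p f : ℝ) (n : ℕ) : Matrix (Fin 3) (Fin 3) ℝ :=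
  ringSplit p f * ringTogether p f ^ n * ringT p f

/-- The effective collision matrix of the ring approximation: the total amplitude for an incoming
pair `hat b` to separate in the directions of `hat a`, at the same or a later vertex. -/
def effectiveU (p f : ℝ) : Matrix (Fin 3) (Fin 3) ℝ :=
  .of fun a b => ringU p f a b + ∑' n, ringDelayed p f n a b

/-! ### The shift of the eigenvalue -/

/-- The vector `(-1, 0, 1)`, on bits or on pairs of bits. -/
def q2 : Fin 3 → ℝ := ![-1, 0, 1]

/-- The correction to the Jacobian contributed by diagrams whose part between the initial and the
final vertex has the total weight `Y`. -/
def jCorrection (p f : ℝ) (Y : Matrix (Fin 3) (Fin 3) ℝ) : Matrix (Fin 3) (Fin 3) ℝ :=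
  vertex12 p f * Y * vertex21 p f

/-- `δ` is the (absolutely convergent) shift of the eigenvalue `-3 p f` of the Jacobian on `q2`
when the diagrams with inner part `Y n`, of every length `n`, are added: every partial sum of the
corrected Jacobian has `q2` as a left and right eigenvector, and the eigenvalues are the partial
sums of `-3 p f` plus a series with sum `δ`. -/
def IsEigenvalueShift (p f : ℝ) (Y : ℕ → Matrix (Fin 3) (Fin 3) ℝ) (δ : ℝ) : Prop :=
  ∃ c : ℕ → ℝ,
    (∀ τ : ℕ,
      q2 ᵥ* (jacobian p f + ∑ n ∈ range τ, jCorrection p f (Y n))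
          = (-3 * p * f + ∑ n ∈ range τ, c n) • q2 ∧
      (jacobian p f + ∑ n ∈ range τ, jCorrection p f (Y n)) *ᵥ q2
          = (-3 * p * f + ∑ n ∈ range τ, c n) • q2) ∧
    (∀ n, c n = 9 * p ^ 2 * f * (1 - f) * (Y n 2 2 - Y n 0 2)) ∧
    HasSum c δ

end OneD3P

end

open OneD3P

/-!
The coefficients `cvc p f {i} {j}` form the doubly stochastic matrix `(1 - 3g) I + g (1 1ᵀ)` with
`g = f p < 1/2`, so two virtual particles (VPs) at distinct sites are two independent random walks,
and the first-meeting matrix `M` consists of probabilities of disjoint events. Its series therefore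
converge, and its eigenvalue `l` on `q2` satisfies `|l| ≤ 1` (`sum_abs_oddAmp_stop_le_one`).

Everything is invariant under the reflection `x ↦ -x` of the line, which exchanges the bits `-` and
`+`. The odd vectors on the three bits are the multiples of `q2`, so every reflection-invariant
matrix has `q2` as a left and a right eigenvector (`vecMul_q2_of_rev`, `mulVec_q2_of_rev`), and the
problem reduces to scalar sequences.

Both approximations, and the first-meeting sum, are instances of one recursion, `pairAmp`, in the
distance and the directions of the two VPs; they differ only in the rule for a step that starts with
both VPs at one site. Splitting a diagram at the first meeting (`pairAmp_renewal`) gives a renewal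
equation, in which each meeting has the weight `v` (BBGKY) or `w` (ring: the VPs separate at once,
or leave in a common direction and separate later, which contributes a geometric series). Since the
absolute weights of a meeting sum to less than one, the renewal equation can be summed
(`hasSum_of_renewal`), with the values `l / (1 - l v)` and `l / (1 - l w)`. Eliminating `l` from the
two shifts gives the algebraic relation.
-/

noncomputable section

namespace OneD3P

/-! ### The correlation vertex coefficients -/

/-- The coefficient of `p` in `meanVertex p μ ν`. -/
def meanVertexSlope (μ ν : Finset (Fin 3)) : ℤ :=
  if ν.card = 2 then ∑ a ∈ univ.filter (fun a => μ ⊆ hat a), (if hat a = ν then -2 else 1) else 0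

/-- The transition probabilities are affine in `p` with integer coefficients, so that the sums over
states reduce to finite computations with integers. -/
theorem transition_eq (p : ℝ) (s s' : Finset (Fin 3)) :
    transition p s s' = ((if s = s' then 1 else 0 : ℤ) : ℝ)
      + p * ((if s.card = 2 ∧ s'.card = 2 then (if s = s' then -2 else 1) else 0 : ℤ) : ℝ) := by
  unfold transition
  split_ifs <;> push_cast <;> ring

theorem meanVertex_eq (p : ℝ) (μ ν : Finset (Fin 3)) :
    meanVertex p μ ν = ((if μ = ν then 1 else 0 : ℤ) : ℝ) + p * (meanVertexSlope μ ν : ℝ) := by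
  have h0 : ∀ μ ν : Finset (Fin 3), (∑ s' ∈ univ.filter (fun s' => μ ⊆ s'), ∑ s ∈ ν.powerset,
      (-1) ^ (ν.card - s.card) * (if s = s' then 1 else 0 : ℤ)) = if μ = ν then 1 else 0 := by
    decide
  have h1 : ∀ μ ν : Finset (Fin 3), (∑ s' ∈ univ.filter (fun s' => μ ⊆ s'), ∑ s ∈ ν.powerset,
      (-1) ^ (ν.card - s.card) *
        (if s.card = 2 ∧ s'.card = 2 then (if s = s' then -2 else 1) else 0 : ℤ))
      = meanVertexSlope μ ν := by
    decide
  rw [← h0, ← h1, meanVertex]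
  push_cast
  simp only [transition_eq, mul_add, Finset.sum_add_distrib, Finset.mul_sum]
  push_cast
  congr 1
  refine Finset.sum_congr rfl fun _ _ => Finset.sum_congr rfl fun _ _ => ?_
  ring

/-- The integer coefficient of `f ^ k` in the sum that defines a correlation vertex coefficient,
when the mean vertex coefficients are the integers `m`. -/
def cvcCoeff (m : Finset (Fin 3) → Finset (Fin 3) → ℤ) (α β : Finset (Fin 3)) (k : ℕ) : ℤ :=
  ∑ μ ∈ α.powerset, ∑ ν ∈ univ.filter (fun ν => β ⊆ ν),
    if (α \ μ).card + (ν \ β).card = k then (-1) ^ (α \ μ).card * m μ ν else 0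

theorem cvc_eq (p f : ℝ) (α β : Finset (Fin 3)) :
    cvc p f α β = ∑ k ∈ range 7, f ^ k *
      ((cvcCoeff (fun μ ν => if μ = ν then 1 else 0) α β k : ℝ)
        + p * (cvcCoeff meanVertexSlope α β k : ℝ)) := by
  have hcard : ∀ s : Finset (Fin 3), s.card ≤ 3 := by decide
  simp only [cvcCoeff, Int.cast_sum, Finset.mul_sum, ← Finset.sum_add_distrib, cvc]
  refine Eq.trans ?_ Finset.sum_comm
  refine Finset.sum_congr rfl fun μ _ => ?_
  refine Eq.trans ?_ Finset.sum_comm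
  refine Finset.sum_congr rfl fun ν _ => ?_
  rw [Finset.sum_eq_single ((α \ μ).card + (ν \ β).card)]
  · rw [meanVertex_eq]
    simp only [if_true]
    push_cast
    ring
  · intro k _ hk
    simp [hk.symm]
  · intro h
    have := hcard (α \ μ)
    have := hcard (ν \ β)
    exact absurd (Finset.mem_range.2 (by omega)) h

theorem cvc_eq_of_coeff (p f : ℝ) {α β : Finset (Fin 3)} {c d : ℕ → ℤ}
    (hc : ∀ k < 7, cvcCoeff (fun μ ν => if μ = ν then 1 else 0) α β k = c k)
    (hd : ∀ k < 7, cvcCoeff meanVertexSlope α β k = d k) :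
    cvc p f α β = ∑ k ∈ range 7, f ^ k * ((c k : ℝ) + p * (d k : ℝ)) := by
  rw [cvc_eq]
  refine Finset.sum_congr rfl fun k hk => ?_
  rw [hc k (Finset.mem_range.1 hk), hd k (Finset.mem_range.1 hk)]

/-- Conservation of probability: a virtual particle that enters a vertex cannot disappear there. -/
theorem cvc_empty_single (p f : ℝ) (j : Fin 3) : cvc p f ∅ {j} = 0 := by
  have h0 : ∀ j : Fin 3, ∀ k < 7, cvcCoeff (fun μ ν => if μ = ν then 1 else 0) ∅ {j} k = 0 := by
    decide
  have h1 : ∀ j : Fin 3, ∀ k < 7, cvcCoeff meanVertexSlope ∅ {j} k = 0 := by decide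
  rw [cvc_eq_of_coeff p f (h0 j) (h1 j)]
  simp

theorem cvc_single_single (p f : ℝ) (i j : Fin 3) :
    cvc p f {i} {j} = (if i = j then 1 - 3 * (f * p) else 0) + f * p := by
  have h0 : ∀ i j : Fin 3, ∀ k < 7, cvcCoeff (fun μ ν => if μ = ν then 1 else 0) {i} {j} k =
      if i = j ∧ k = 0 then 1 else 0 := by decide
  have h1 : ∀ i j : Fin 3, ∀ k < 7, cvcCoeff meanVertexSlope {i} {j} k =
      if k = 1 then (if i = j then -2 else 1) else 0 := by decide
  rw [cvc_eq_of_coeff p f (h0 i j) (h1 i j)]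
  by_cases h : i = j <;> simp [Finset.sum_range_succ, h]
  all_goals ring

theorem cvc_single_hat (p f : ℝ) (i b : Fin 3) :
    cvc p f {i} (hat b) = (if i = b then 3 * p else 0) + -p := by
  have h0 : ∀ i b : Fin 3, ∀ k < 7,
      cvcCoeff (fun μ ν => if μ = ν then 1 else 0) {i} (hat b) k = 0 := by decide
  have h1 : ∀ i b : Fin 3, ∀ k < 7, cvcCoeff meanVertexSlope {i} (hat b) k =
      if k = 0 then (if i = b then 2 else -1) else 0 := by decide
  rw [cvc_eq_of_coeff p f (h0 i b) (h1 i b)]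
  by_cases h : i = b <;> simp [h]
  all_goals ring

theorem cvc_hat_single (p f : ℝ) (a j : Fin 3) :
    cvc p f (hat a) {j} = (if a = j then 3 * p * f * (1 - f) else 0) + -(p * f * (1 - f)) := by
  have h0 : ∀ a j : Fin 3, ∀ k < 7,
      cvcCoeff (fun μ ν => if μ = ν then 1 else 0) (hat a) {j} k = 0 := by decide
  have h1 : ∀ a j : Fin 3, ∀ k < 7, cvcCoeff meanVertexSlope (hat a) {j} k =
      if k = 1 then (if a = j then 2 else -1) else
        if k = 2 then (if a = j then -2 else 1) else 0 := by decide
  rw [cvc_eq_of_coeff p f (h0 a j) (h1 a j)]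
  by_cases h : a = j <;> simp [Finset.sum_range_succ, h] <;> ring

theorem cvc_hat_hat (p f : ℝ) (a b : Fin 3) :
    cvc p f (hat a) (hat b) = (if a = b then 1 - 3 * p + 3 * p * f else 0) + p * (1 - f) := by
  have h0 : ∀ a b : Fin 3, ∀ k < 7,
      cvcCoeff (fun μ ν => if μ = ν then 1 else 0) (hat a) (hat b) k =
        if a = b ∧ k = 0 then 1 else 0 := by decide
  have h1 : ∀ a b : Fin 3, ∀ k < 7, cvcCoeff meanVertexSlope (hat a) (hat b) k =
      if k = 0 then (if a = b then -2 else 1) else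
        if k = 1 then (if a = b then 2 else -1) else 0 := by decide
  rw [cvc_eq_of_coeff p f (h0 a b) (h1 a b)]
  by_cases h : a = b <;> simp [Finset.sum_range_succ, h] <;> ring

/-! ### Matrices with the eigenvector `q2` -/

theorem vecMul_q2 (A : Matrix (Fin 3) (Fin 3) ℝ) (b : Fin 3) : (q2 ᵥ* A) b = A 2 b - A 0 b := by
  simp [Matrix.vecMul, dotProduct, Fin.sum_univ_three, q2]
  ring

theorem mulVec_q2 (A : Matrix (Fin 3) (Fin 3) ℝ) (a : Fin 3) : (A *ᵥ q2) a = A a 2 - A a 0 := by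
  simp [Matrix.mulVec, dotProduct, Fin.sum_univ_three, q2]
  ring

theorem vecMul_q2_of_entries {A : Matrix (Fin 3) (Fin 3) ℝ} {c e : ℝ}
    (h : ∀ a b, A a b = (if a = b then c else 0) + e) : q2 ᵥ* A = c • q2 := by
  ext b
  rw [vecMul_q2]
  fin_cases b <;> simp [h, q2]

theorem mulVec_q2_of_entries {A : Matrix (Fin 3) (Fin 3) ℝ} {c e : ℝ}
    (h : ∀ a b, A a b = (if a = b then c else 0) + e) : A *ᵥ q2 = c • q2 := by
  ext b
  rw [mulVec_q2]
  fin_cases b <;> simp [h, q2]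

/-- The reflection of the bits exchanges `-` and `+`; its odd vectors are the multiples of `q2`. -/
theorem vecMul_q2_of_rev {A : Matrix (Fin 3) (Fin 3) ℝ}
    (h : ∀ a b, A a.rev b.rev = A a b) : q2 ᵥ* A = (A 2 2 - A 0 2) • q2 := by
  have h0 : A 2 0 = A 0 2 := h 0 2
  have h1 : A 0 0 = A 2 2 := h 2 2
  have h2 : A 0 1 = A 2 1 := h 2 1
  ext b
  rw [vecMul_q2]
  fin_cases b <;> simp [q2, h0, h1, h2]

theorem mulVec_q2_of_rev {A : Matrix (Fin 3) (Fin 3) ℝ}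
    (h : ∀ a b, A a.rev b.rev = A a b) : A *ᵥ q2 = (A 2 2 - A 0 2) • q2 := by
  have h0 : A 2 0 = A 0 2 := h 0 2
  have h1 : A 0 0 = A 2 2 := h 2 2
  have h2 : A 1 0 = A 1 2 := h 1 2
  ext b
  rw [mulVec_q2]
  fin_cases b <;> simp [q2, h0, h1, h2]

/-- If the inner parts `Y n` are invariant under reflection, then the eigenvalue shift is the sum
of their eigenvalues on `q2`, up to the product of the eigenvalues of the two outer vertices. -/
theorem isEigenvalueShift_of_hasSum {p f y : ℝ} {Y : ℕ → Matrix (Fin 3) (Fin 3) ℝ}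
    (hY : ∀ n a b, Y n a.rev b.rev = Y n a b)
    (hy : HasSum (fun n => Y n 2 2 - Y n 0 2) y) :
    IsEigenvalueShift p f Y (9 * p ^ 2 * f * (1 - f) * y) := by
  refine ⟨fun n => 9 * p ^ 2 * f * (1 - f) * (Y n 2 2 - Y n 0 2), fun τ => ?_, fun n => rfl,
    hy.mul_left _⟩
  have hJ : ∀ i j, jacobian p f i j = (if i = j then -3 * p * f else 0) + f * p := by
    intro i j
    simp only [jacobian, Matrix.sub_apply, vertex11, Matrix.of_apply, cvc_single_single,
      Matrix.one_apply]
    split_ifs <;> ring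
  have h12 : ∀ i b, vertex12 p f i b = (if i = b then 3 * p else 0) + -p := cvc_single_hat p f
  have h21 : ∀ a j, vertex21 p f a j =
      (if a = j then 3 * p * f * (1 - f) else 0) + -(p * f * (1 - f)) := cvc_hat_single p f
  constructor
  · rw [Matrix.vecMul_add, vecMul_q2_of_entries hJ, add_smul, Finset.sum_smul,
      Matrix.vecMul_sum]
    congr 1
    refine Finset.sum_congr rfl fun n _ => ?_
    rw [jCorrection, ← Matrix.vecMul_vecMul, ← Matrix.vecMul_vecMul, vecMul_q2_of_entries h12,
      Matrix.smul_vecMul, vecMul_q2_of_rev (hY n), Matrix.smul_vecMul, Matrix.smul_vecMul,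
      vecMul_q2_of_entries h21, smul_smul, smul_smul]
    congr 1
    ring
  · rw [Matrix.add_mulVec, mulVec_q2_of_entries hJ, add_smul, Finset.sum_smul,
      Matrix.sum_mulVec]
    congr 1
    refine Finset.sum_congr rfl fun n _ => ?_
    rw [jCorrection, ← Matrix.mulVec_mulVec, ← Matrix.mulVec_mulVec, mulVec_q2_of_entries h21,
      Matrix.mulVec_smul, mulVec_q2_of_rev (hY n), Matrix.mulVec_smul, Matrix.mulVec_smul,
      mulVec_q2_of_entries h12, smul_smul, smul_smul]
    congr 1
    ring

/-! ### Renewal sequences -/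

/-- The generating-function identities `y = φ z`, `z = 1 + X (u y + t x)`, `x = X (s y + θ x)` of a
renewal process, solved for `y` at `X = 1`. Here `φ` counts first meetings, `y` and `z` all
continuations of a start and of a meeting, and `x` those of a state in which the VPs move together.
The effective weight of a renewal is `u + t s / (1 - θ)`; the conditions on the absolute values make all series converge absolutely. -/
theorem hasSum_of_renewal {φ x y z : ℕ → ℝ} {l u t s θ : ℝ}
    (hφ : HasSum φ l) (hφ1 : ∀ N, ∑ n ∈ range N, |φ n| ≤ 1)
    (hy : ∀ n, y n = ∑ k ∈ antidiagonal n, φ k.1 * z k.2)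
    (hz0 : z 0 = 1) (hz : ∀ n, z (n + 1) = u * y n + t * x n)
    (hx0 : x 0 = 0) (hx : ∀ n, x (n + 1) = s * y n + θ * x n)
    (hθ : |θ| < 1) (hu : |u| + |t| * (|s| / (1 - |θ|)) < 1) :
    HasSum y (l / (1 - l * (u + t * s / (1 - θ)))) := by
  have hθ' : 0 < 1 - |θ| := by linarith
  have hφs : Summable fun n => |φ n| :=
    summable_of_sum_range_le (fun n => abs_nonneg _) hφ1
  have hφl : ∑' n, |φ n| ≤ 1 := hφs.tsum_le_of_sum_range_le hφ1
  -- The three recursions bound the partial sums of `|x|`, `|z|` and `|y|` by one another.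
  have hAx : ∀ N, ∑ n ∈ range N, |x n| ≤ |s| / (1 - |θ|) * ∑ n ∈ range N, |y n| := by
    intro N
    have h1 : ∑ n ∈ range N, |x n| ≤ |s| * ∑ n ∈ range N, |y n| + |θ| * ∑ n ∈ range N, |x n| := by
      cases N with
      | zero => simp
      | succ N =>
        calc ∑ n ∈ range (N + 1), |x n| = ∑ n ∈ range N, |x (n + 1)| := by
              rw [Finset.sum_range_succ', hx0, abs_zero, add_zero]
          _ ≤ ∑ n ∈ range N, (|s| * |y n| + |θ| * |x n|) := by
              refine Finset.sum_le_sum fun n _ => ?_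
              rw [hx, ← abs_mul, ← abs_mul]
              exact abs_add_le _ _
          _ ≤ ∑ n ∈ range (N + 1), (|s| * |y n| + |θ| * |x n|) := by
              rw [Finset.sum_range_succ]
              exact le_add_of_nonneg_right (by positivity)
          _ = _ := by rw [Finset.sum_add_distrib, Finset.mul_sum, Finset.mul_sum]
    rw [div_mul_eq_mul_div, le_div_iff₀ hθ']
    linarith
  have hAz : ∀ N, ∑ n ∈ range N, |z n| ≤
      1 + |u| * ∑ n ∈ range N, |y n| + |t| * ∑ n ∈ range N, |x n| := by
    intro N
    cases N with
    | zero => simp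
    | succ N =>
      rw [add_assoc]
      calc ∑ n ∈ range (N + 1), |z n| = 1 + ∑ n ∈ range N, |z (n + 1)| := by
            rw [Finset.sum_range_succ', hz0, abs_one, add_comm]
        _ ≤ 1 + ∑ n ∈ range N, (|u| * |y n| + |t| * |x n|) := by
            refine add_le_add_right (Finset.sum_le_sum fun n _ => ?_) _
            rw [hz, ← abs_mul, ← abs_mul]
            exact abs_add_le _ _
        _ ≤ 1 + ∑ n ∈ range (N + 1), (|u| * |y n| + |t| * |x n|) := by
            rw [Finset.sum_range_succ]
            exact add_le_add_right (le_add_of_nonneg_right (by positivity)) _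
        _ = _ := by rw [Finset.sum_add_distrib, Finset.mul_sum, Finset.mul_sum]
  have hAy : ∀ N, ∑ n ∈ range N, |y n| ≤ ∑ n ∈ range N, |z n| := by
    intro N
    calc ∑ n ∈ range N, |y n|
        ≤ ∑ n ∈ range N, ∑ k ∈ range (n + 1), |φ k| * |z (n - k)| := by
          refine Finset.sum_le_sum fun n _ => ?_
          rw [hy, Finset.Nat.sum_antidiagonal_eq_sum_range_succ (fun i j => φ i * z j)]
          refine (Finset.abs_sum_le_sum_abs _ _).trans (le_of_eq ?_)
          exact Finset.sum_congr rfl fun _ _ => abs_mul _ _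
      _ = ∑ k ∈ range N, ∑ m ∈ range (N - k), |φ k| * |z m| :=
          Finset.sum_sigma' .. |>.trans <| by
            rw [Finset.sum_sigma']
            refine Finset.sum_bij' (fun a _ => ⟨a.2, a.1 - a.2⟩) (fun a _ => ⟨a.1 + a.2, a.1⟩)
              ?_ ?_ ?_ ?_ ?_ <;> rintro ⟨a, b⟩ h <;> simp at h ⊢ <;> omega
      _ ≤ ∑ k ∈ range N, |φ k| * ∑ m ∈ range N, |z m| := by
          refine Finset.sum_le_sum fun k _ => ?_
          rw [← Finset.mul_sum]
          refine mul_le_mul_of_nonneg_left ?_ (abs_nonneg _)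
          exact Finset.sum_le_sum_of_subset_of_nonneg (Finset.range_mono (Nat.sub_le _ _))
            fun _ _ _ => abs_nonneg _
      _ ≤ ∑ m ∈ range N, |z m| := by
          rw [← Finset.sum_mul]
          exact mul_le_of_le_one_left (Finset.sum_nonneg fun _ _ => abs_nonneg _) (hφ1 N)
  have hys : Summable fun n => |y n| := by
    refine summable_of_sum_range_le (c := 1 / (1 - (|u| + |t| * (|s| / (1 - |θ|)))))
      (fun n => abs_nonneg _) fun N => ?_
    rw [le_div_iff₀ (by linarith)]
    have h1 := hAy N
    have h2 := hAz N
    have h3 := mul_le_mul_of_nonneg_left (hAx N) (abs_nonneg t)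
    linarith
  have hxs : Summable fun n => |x n| := by
    refine summable_of_sum_range_le (c := |s| / (1 - |θ|) * ∑' n, |y n|)
      (fun n => abs_nonneg _) fun N => ?_
    refine (hAx N).trans (mul_le_mul_of_nonneg_left ?_ (by positivity))
    exact hys.sum_le_tsum _ fun _ _ => abs_nonneg _
  have hzs : Summable fun n => |z n| := by
    refine (summable_nat_add_iff 1).1 ?_
    refine Summable.of_nonneg_of_le (fun n => abs_nonneg _) (fun n => ?_)
      ((hys.mul_left |u|).add (hxs.mul_left |t|))
    rw [hz, ← abs_mul, ← abs_mul]
    exact abs_add_le _ _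
  have ey : ∑' n, y n = l * ∑' n, z n := by
    rw [← hφ.tsum_eq, tsum_mul_tsum_eq_tsum_sum_antidiagonal_of_summable_norm
      (by simpa only [Real.norm_eq_abs] using hφs) (by simpa only [Real.norm_eq_abs] using hzs)]
    exact tsum_congr hy
  have ez : ∑' n, z n = 1 + (u * ∑' n, y n + t * ∑' n, x n) := by
    rw [hzs.of_abs.tsum_eq_zero_add, hz0, ← tsum_mul_left, ← tsum_mul_left,
      ← (hys.of_abs.mul_left u).tsum_add (hxs.of_abs.mul_left t)]
    simp only [hz]
  have ex : ∑' n, x n = s * ∑' n, y n + θ * ∑' n, x n := by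
    conv_lhs => rw [hxs.of_abs.tsum_eq_zero_add, hx0, zero_add]
    rw [← tsum_mul_left, ← tsum_mul_left,
      ← (hys.of_abs.mul_left s).tsum_add (hxs.of_abs.mul_left θ)]
    simp only [hx]
  have hθ1 : 1 - θ ≠ 0 := by
    have := le_abs_self θ
    linarith
  have hl : |l| ≤ 1 := by
    rw [← hφ.tsum_eq]
    have h1 := norm_tsum_le_tsum_norm (f := φ) (by simpa only [Real.norm_eq_abs] using hφs)
    simp only [Real.norm_eq_abs] at h1
    exact h1.trans hφl
  have hw : |u + t * s / (1 - θ)| < 1 := by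
    refine lt_of_le_of_lt (abs_add_le _ _) (lt_of_le_of_lt ?_ hu)
    rw [mul_div_assoc, abs_mul, abs_div]
    have h1 : 1 - |θ| ≤ |1 - θ| := by
      have := le_abs_self θ
      exact le_trans (by linarith) (le_abs_self _)
    gcongr
  have hd : 1 - l * (u + t * s / (1 - θ)) ≠ 0 := by
    have h1 : |l * (u + t * s / (1 - θ))| < 1 := by
      rw [abs_mul]
      exact lt_of_le_of_lt (mul_le_of_le_one_left (abs_nonneg _) hl) hw
    have := le_abs_self (l * (u + t * s / (1 - θ)))
    linarith
  have ex' : ∑' n, x n = s / (1 - θ) * ∑' n, y n := by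
    field_simp
    linarith
  rw [ez, ex'] at ey
  rw [(div_eq_iff hd).2 (by linear_combination -ey : l = (∑' n, y n) * _)]
  exact hys.of_abs.hasSum

/-! ### Pairs of virtual particles as a relative random walk -/

/-- The amplitude of independent one-to-one vertices: two VPs that enter them in the directions
`i`, `j`, the second at distance `d` to the right of the first, continue with the amplitudes `F`. -/
def indepStep (p f : ℝ) (F : ℤ → Fin 3 → Fin 3 → ℝ) (d : ℤ) (i j : Fin 3) : ℝ :=
  ∑ i', ∑ j', cvc p f {i'} {i} * cvc p f {j'} {j} * F (d + velocity j' - velocity i') i' j'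

/-- The total weight of the diagrams in which two VPs, incoming in the directions `i` and `j` at
two sites of which the second lies `d` to the right of the first, pass through `n` time steps and
then meet in the directions `hat a`. At distinct sites the VPs propagate independently; `contact`
is the rule for a step that starts with both of them at one site. -/
def pairAmp (p f : ℝ) (contact : (ℤ → Fin 3 → Fin 3 → ℝ) → Fin 3 → Fin 3 → ℝ) :
    ℕ → Fin 3 → ℤ → Fin 3 → Fin 3 → ℝ
  | 0, a, d, i, j => if d = 0 ∧ ({i, j} : Finset (Fin 3)) = hat a then 1 else 0
  | n + 1, a, d, i, j =>
      if d = 0 then contact (pairAmp p f contact n a) i j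
      else indepStep p f (pairAmp p f contact n a) d i j

/-- The contact rule that stops a diagram at the first meeting. -/
def stopContact : (ℤ → Fin 3 → Fin 3 → ℝ) → Fin 3 → Fin 3 → ℝ := fun _ _ _ => 0

/-- The contact rule of the ring approximation: the VPs ignore each other. -/
def ringContact (p f : ℝ) : (ℤ → Fin 3 → Fin 3 → ℝ) → Fin 3 → Fin 3 → ℝ :=
  fun F => indepStep p f F 0

/-- The contact rule of the two-particle BBGKY approximation: VPs at one site pass through a
two-to-two vertex. -/
def bbgkyContact (p f : ℝ) : (ℤ → Fin 3 → Fin 3 → ℝ) → Fin 3 → Fin 3 → ℝ :=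
  fun F i j => ∑ a, cvc p f (hat a) {i, j} * F (velocity (a + 2) - velocity (a + 1)) (a + 1) (a + 2)

/-- Compatibility of a contact rule with the reflection of the line, in which the two VPs also
change their order, so that their distance keeps its sign. -/
def IsReflective (contact : (ℤ → Fin 3 → Fin 3 → ℝ) → Fin 3 → Fin 3 → ℝ) : Prop :=
  ∀ F G : ℤ → Fin 3 → Fin 3 → ℝ, (∀ d i j, F d j.rev i.rev = G d i j) →
    ∀ i j, contact F j.rev i.rev = contact G i j

/-- Compatibility of a contact rule with the interchange of the two VPs. -/
def IsSymmetric (contact : (ℤ → Fin 3 → Fin 3 → ℝ) → Fin 3 → Fin 3 → ℝ) : Prop :=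
  ∀ F : ℤ → Fin 3 → Fin 3 → ℝ, (∀ d i j, F (-d) j i = F d i j) →
    ∀ i j, contact F j i = contact F i j

variable {p f : ℝ} {contact : (ℤ → Fin 3 → Fin 3 → ℝ) → Fin 3 → Fin 3 → ℝ}

theorem velocity_rev (i : Fin 3) : velocity i.rev = -velocity i := by
  revert i; decide

theorem cvc_single_rev (i j : Fin 3) : cvc p f {i.rev} {j.rev} = cvc p f {i} {j} := by
  simp only [cvc_single_single, Fin.rev_inj]

theorem indepStep_rev {F G : ℤ → Fin 3 → Fin 3 → ℝ} (h : ∀ d i j, F d j.rev i.rev = G d i j)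
    (d : ℤ) (i j : Fin 3) : indepStep p f F d j.rev i.rev = indepStep p f G d i j := by
  unfold indepStep
  rw [Finset.sum_comm, ← Equiv.sum_comp Fin.revPerm]
  refine Finset.sum_congr rfl fun i' _ => ?_
  rw [← Equiv.sum_comp Fin.revPerm]
  refine Finset.sum_congr rfl fun j' _ => ?_
  simp only [Fin.revPerm_apply, cvc_single_rev, velocity_rev]
  rw [← h]
  rw [mul_comm (cvc p f {j'} {j})]
  congr 2
  ring

theorem indepStep_swap {F : ℤ → Fin 3 → Fin 3 → ℝ} (h : ∀ d i j, F (-d) j i = F d i j)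
    (d : ℤ) (i j : Fin 3) : indepStep p f F (-d) j i = indepStep p f F d i j := by
  unfold indepStep
  rw [Finset.sum_comm]
  refine Finset.sum_congr rfl fun i' _ => Finset.sum_congr rfl fun j' _ => ?_
  rw [← h, mul_comm (cvc p f {j'} {j})]
  congr 2
  ring

theorem isReflective_stop : IsReflective stopContact := fun _ _ _ _ _ => rfl

theorem isReflective_ring : IsReflective (ringContact p f) := fun _ _ h => indepStep_rev h 0

theorem isReflective_bbgky : IsReflective (bbgkyContact p f) := by
  intro F G h i j
  unfold bbgkyContact
  rw [← Equiv.sum_comp Fin.revPerm]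
  refine Finset.sum_congr rfl fun a _ => ?_
  have h1 : ∀ a : Fin 3, a.rev + 1 = (a + 2).rev := by decide
  have h2 : ∀ a : Fin 3, a.rev + 2 = (a + 1).rev := by decide
  simp only [Fin.revPerm_apply, h1, h2, h, velocity_rev]
  congr 1
  · have h3 : ∀ i j : Fin 3, i ≠ j → ∃ b, ({i, j} : Finset (Fin 3)) = hat b ∧
        ({j.rev, i.rev} : Finset (Fin 3)) = hat b.rev := by decide
    by_cases hij : i = j
    · subst hij
      simp [cvc_hat_single, Fin.rev_inj]
    · obtain ⟨b, hb, hb'⟩ := h3 i j hij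
      simp only [hb, hb', cvc_hat_hat, Fin.rev_inj]
  · congr 1
    ring

theorem isSymmetric_ring : IsSymmetric (ringContact p f) := fun F h i j => by
  have := indepStep_swap (p := p) (f := f) h 0 i j
  rwa [neg_zero] at this

theorem isSymmetric_bbgky : IsSymmetric (bbgkyContact p f) := fun F _ i j => by
  simp only [bbgkyContact, Finset.pair_comm]

theorem pairAmp_rev (hc : IsReflective contact) (n : ℕ) (a : Fin 3) (d : ℤ) (i j : Fin 3) :
    pairAmp p f contact n a.rev d j.rev i.rev = pairAmp p f contact n a d i j := by
  induction n generalizing d i j with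
  | zero =>
    have h : ∀ a i j : Fin 3, ({j.rev, i.rev} : Finset (Fin 3)) = hat a.rev ↔
        ({i, j} : Finset (Fin 3)) = hat a := by decide
    simp only [pairAmp, h]
  | succ n ih =>
    simp only [pairAmp, hc _ _ ih, indepStep_rev ih]

theorem pairAmp_swap (hc : IsSymmetric contact) (n : ℕ) (a : Fin 3) (d : ℤ) (i j : Fin 3) :
    pairAmp p f contact n a (-d) j i = pairAmp p f contact n a d i j := by
  induction n generalizing d i j with
  | zero => simp only [pairAmp, neg_eq_zero, Finset.pair_comm]
  | succ n ih => simp only [pairAmp, neg_eq_zero, hc _ ih, indepStep_swap ih]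

theorem exists_hat {i j : Fin 3} (h : i ≠ j) :
    ∃ b, (i = b + 1 ∧ j = b + 2) ∨ (i = b + 2 ∧ j = b + 1) := by
  revert i j; decide

theorem pair_eq_hat_iff (b a : Fin 3) : ({b + 1, b + 2} : Finset (Fin 3)) = hat a ↔ a = b := by
  revert b a; decide

/-- Two VPs at one site have met already, so only the term of length zero contributes. -/
theorem pairAmp_renewal_contact (hc : IsSymmetric contact) (n : ℕ) (a : Fin 3) {i j : Fin 3}
    (hij : i ≠ j) :
    pairAmp p f contact n a 0 i j = ∑ k ∈ antidiagonal n, ∑ c,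
      pairAmp p f stopContact k.1 c 0 i j * pairAmp p f contact k.2 a 0 (c + 1) (c + 2) := by
  rw [Finset.sum_eq_single (0, n)]
  · have key : ∀ b, pairAmp p f contact n a 0 (b + 1) (b + 2) = ∑ c,
        pairAmp p f stopContact 0 c 0 (b + 1) (b + 2)
          * pairAmp p f contact n a 0 (c + 1) (c + 2) := by
      intro b
      simp [pairAmp, pair_eq_hat_iff]
    obtain ⟨b, ⟨rfl, rfl⟩ | ⟨rfl, rfl⟩⟩ := exists_hat hij
    · exact key b
    · rw [← pairAmp_swap hc, neg_zero, key b]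
      simp only [pairAmp, Finset.pair_comm]
  · rintro ⟨m, k⟩ hk hne
    cases m with
    | zero =>
      simp at hk hne
      exact absurd hk hne
    | succ m => simp [pairAmp, stopContact]
  · simp

/-- Decomposition of a diagram at the first meeting of its two VPs. -/
theorem pairAmp_renewal (hc : IsSymmetric contact) (n : ℕ) (a : Fin 3) (d : ℤ) (i j : Fin 3)
    (h : d = 0 → i ≠ j) :
    pairAmp p f contact n a d i j = ∑ k ∈ antidiagonal n, ∑ c,
      pairAmp p f stopContact k.1 c d i j * pairAmp p f contact k.2 a 0 (c + 1) (c + 2) := by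
  induction n generalizing d i j with
  | zero =>
    by_cases hd : d = 0
    · subst hd
      exact pairAmp_renewal_contact hc 0 a (h rfl)
    · simp [pairAmp, hd]
  | succ n ih =>
    by_cases hd : d = 0
    · subst hd
      exact pairAmp_renewal_contact hc _ a (h rfl)
    -- VPs that leave distinct sites in a common direction do not meet at the next step.
    have step : ∀ i' j' : Fin 3, pairAmp p f contact n a (d + velocity j' - velocity i') i' j' =
        ∑ k ∈ antidiagonal n, ∑ c,
          pairAmp p f stopContact k.1 c (d + velocity j' - velocity i') i' j'
            * pairAmp p f contact k.2 a 0 (c + 1) (c + 2) := by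
      refine fun i' j' => ih _ _ _ ?_
      rintro h0 rfl
      exact hd (by linarith)
    have h0 : ∀ c, pairAmp p f stopContact 0 c d i j = 0 := fun c => by simp [pairAmp, hd]
    have h1 : ∀ m c, pairAmp p f stopContact (m + 1) c d i j =
        indepStep p f (pairAmp p f stopContact m c) d i j := fun m c => by simp [pairAmp, hd]
    rw [Finset.Nat.sum_antidiagonal_succ]
    simp only [h0, h1, zero_mul, Finset.sum_const_zero, zero_add]
    rw [pairAmp, if_neg hd]
    simp only [indepStep, Finset.sum_mul, step, Finset.mul_sum]
    refine (Finset.sum_congr rfl fun i' _ => Finset.sum_comm).trans (Finset.sum_comm.trans ?_)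
    refine Finset.sum_congr rfl fun k _ => ?_
    refine (Finset.sum_congr rfl fun i' _ => Finset.sum_comm).trans (Finset.sum_comm.trans ?_)
    refine Finset.sum_congr rfl fun c _ => Finset.sum_congr rfl fun i' _ =>
      Finset.sum_congr rfl fun j' _ => ?_
    ring

/-! ### The first meeting is an event of probability at most one -/

theorem cvc_single_nonneg (hg : 0 ≤ f * p) (hg' : f * p ≤ 1 / 2) (i j : Fin 3) :
    0 ≤ cvc p f {i} {j} := by
  rw [cvc_single_single]
  split_ifs <;> linarith

theorem sum_cvc_single (j : Fin 3) : ∑ i, cvc p f {i} {j} = 1 := by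
  simp only [cvc_single_single, Finset.sum_add_distrib, Finset.sum_ite_eq', Finset.mem_univ,
    if_true, Finset.sum_const, Finset.card_univ, Fintype.card_fin, nsmul_eq_mul]
  push_cast
  ring

theorem pairAmp_stop_nonneg (hg : 0 ≤ f * p) (hg' : f * p ≤ 1 / 2) (n : ℕ) (a : Fin 3) (d : ℤ)
    (i j : Fin 3) : 0 ≤ pairAmp p f stopContact n a d i j := by
  induction n generalizing d i j with
  | zero =>
    rw [pairAmp]
    split_ifs <;> norm_num
  | succ n ih =>
    rw [pairAmp]
    split_ifs
    · exact le_rfl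
    · exact Finset.sum_nonneg fun i' _ => Finset.sum_nonneg fun j' _ =>
        mul_nonneg (mul_nonneg (cvc_single_nonneg hg hg' _ _) (cvc_single_nonneg hg hg' _ _))
          (ih _ _ _)

/-- The amplitudes of the first meeting are probabilities of disjoint events. -/
theorem sum_pairAmp_stop_le_one (hg : 0 ≤ f * p) (hg' : f * p ≤ 1 / 2) (N : ℕ) (d : ℤ)
    (i j : Fin 3) : ∑ n ∈ range N, ∑ a, pairAmp p f stopContact n a d i j ≤ 1 := by
  induction N generalizing d i j with
  | zero => simp
  | succ N ih =>
    rw [Finset.sum_range_succ']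
    by_cases hd : d = 0
    · have h1 : ∀ n a, pairAmp p f stopContact (n + 1) a d i j = 0 := fun n a => by
        simp [pairAmp, hd, stopContact]
      have h2 : ∀ i j : Fin 3,
          (univ.filter fun a => ({i, j} : Finset (Fin 3)) = hat a).card ≤ 1 := by
        decide
      simp only [h1, Finset.sum_const_zero, zero_add]
      simp only [pairAmp, hd, true_and, Finset.sum_boole]
      exact_mod_cast h2 i j
    · have h0 : ∀ a, pairAmp p f stopContact 0 a d i j = 0 := fun a => by simp [pairAmp, hd]
      simp only [h0, Finset.sum_const_zero, add_zero]
      simp only [pairAmp, hd, if_false, indepStep]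
      calc ∑ n ∈ range N, ∑ a, ∑ i', ∑ j', cvc p f {i'} {i} * cvc p f {j'} {j}
            * pairAmp p f stopContact n a (d + velocity j' - velocity i') i' j'
          = ∑ i', ∑ j', cvc p f {i'} {i} * cvc p f {j'} {j} * ∑ n ∈ range N, ∑ a,
              pairAmp p f stopContact n a (d + velocity j' - velocity i') i' j' := by
            simp only [Finset.mul_sum]
            refine (Finset.sum_congr rfl fun n _ => Finset.sum_comm).trans
              (Finset.sum_comm.trans ?_)
            refine Finset.sum_congr rfl fun i' _ => ?_
            refine (Finset.sum_congr rfl fun n _ => Finset.sum_comm).trans Finset.sum_comm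
        _ ≤ ∑ i', ∑ j', cvc p f {i'} {i} * cvc p f {j'} {j} :=
            Finset.sum_le_sum fun i' _ => Finset.sum_le_sum fun j' _ =>
              mul_le_of_le_one_right (mul_nonneg (cvc_single_nonneg hg hg' _ _)
                (cvc_single_nonneg hg hg' _ _)) (ih _ _ _)
        _ = 1 := by rw [← Finset.sum_mul_sum, sum_cvc_single, sum_cvc_single, one_mul]

theorem summable_pairAmp_stop (hg : 0 ≤ f * p) (hg' : f * p ≤ 1 / 2) (a : Fin 3) (d : ℤ)
    (i j : Fin 3) : Summable fun n => pairAmp p f stopContact n a d i j := by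
  refine summable_of_sum_range_le (c := 1) (fun n => pairAmp_stop_nonneg hg hg' n a d i j)
    fun N => le_trans (Finset.sum_le_sum fun n _ => ?_) (sum_pairAmp_stop_le_one hg hg' N d i j)
  exact Finset.single_le_sum (f := fun a => pairAmp p f stopContact n a d i j)
    (fun a _ => pairAmp_stop_nonneg hg hg' n a d i j) (Finset.mem_univ a)

/-! ### The odd part of the pair amplitudes -/

/-- The pair amplitude contracted with `q2` at the final vertex. -/
def oddAmp (p f : ℝ) (contact : (ℤ → Fin 3 → Fin 3 → ℝ) → Fin 3 → Fin 3 → ℝ)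
    (n : ℕ) (d : ℤ) (i j : Fin 3) : ℝ :=
  pairAmp p f contact n 2 d i j - pairAmp p f contact n 0 d i j

theorem oddAmp_rev (hc : IsReflective contact) (n : ℕ) (d : ℤ) (i j : Fin 3) :
    oddAmp p f contact n d j.rev i.rev = -oddAmp p f contact n d i j := by
  have h0 := pairAmp_rev (p := p) (f := f) hc n 0 d i j
  have h2 := pairAmp_rev (p := p) (f := f) hc n 2 d i j
  simp only [Fin.reduceRev] at h0 h2
  rw [oddAmp, oddAmp, h0, h2]
  ring

theorem oddAmp_swap (hc : IsSymmetric contact) (n : ℕ) (d : ℤ) (i j : Fin 3) :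
    oddAmp p f contact n (-d) j i = oddAmp p f contact n d i j := by
  rw [oddAmp, oddAmp, pairAmp_swap hc, pairAmp_swap hc]

/-- Pairs met in the directions `hat 2`, `hat 0` contribute with opposite signs, and those met in
the directions `hat 1` do not contribute. -/
theorem oddAmp_renewal (hr : IsReflective contact) (hc : IsSymmetric contact) (n : ℕ) {d : ℤ}
    (hd : d ≠ 0) (i j : Fin 3) :
    oddAmp p f contact n d i j = ∑ k ∈ antidiagonal n,
      oddAmp p f stopContact k.1 d i j * oddAmp p f contact k.2 0 0 1 := by
  have h (a) := pairAmp_renewal (p := p) (f := f) hc n a d i j fun h => absurd h hd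
  have h0 : ∀ k, oddAmp p f contact k 0 1 2 = -oddAmp p f contact k 0 0 1 := fun k =>
    oddAmp_rev hr k 0 0 1
  have h1 : ∀ k, oddAmp p f contact k 0 2 0 = 0 := fun k => by
    have : oddAmp p f contact k 0 2 0 = -oddAmp p f contact k 0 2 0 := oddAmp_rev hr k 0 2 0
    linarith
  rw [oddAmp, h, h, ← Finset.sum_sub_distrib]
  refine Finset.sum_congr rfl fun k _ => ?_
  rw [← Finset.sum_sub_distrib]
  simp only [← mul_sub]
  change ∑ c, _ * oddAmp p f contact k.2 0 (c + 1) (c + 2) = _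
  simp only [Fin.sum_univ_three, Fin.isValue]
  change _ * oddAmp p f contact k.2 0 1 2 + _ * oddAmp p f contact k.2 0 2 0
    + _ * oddAmp p f contact k.2 0 0 1 = _
  rw [h0, h1]
  unfold oddAmp
  ring

/-! ### The diagrams of the two-particle BBGKY approximation -/

theorem mem_atSite {α : Finset (ℤ × Fin 3)} {x : ℤ} {i : Fin 3} :
    i ∈ atSite α x ↔ (x, i) ∈ α := by simp [atSite]

theorem sites_pair (x y : ℤ) (i j : Fin 3) :
    sites {(x, i), (y, j)} = {x, y} := by simp [sites, Finset.image_insert]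

theorem advect_pair (x y : ℤ) (i j : Fin 3) : advect {(x, i), (y, j)} =
    {(x + velocity i, i), (y + velocity j, j)} := by simp [advect, Finset.image_insert]

theorem atSite_pair_left {x y : ℤ} (h : x ≠ y) (i j : Fin 3) :
    atSite {(x, i), (y, j)} x = {i} := by
  ext k; simp [mem_atSite, h]

theorem atSite_pair_right {x y : ℤ} (h : x ≠ y) (i j : Fin 3) :
    atSite {(x, i), (y, j)} y = {j} := by
  ext k; simp [mem_atSite, h.symm]

theorem singleton_product_hat (x : ℤ) (a : Fin 3) :
    ({x} ×ˢ hat a : Finset (ℤ × Fin 3)) = {(x, a + 1), (x, a + 2)} := by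
  rw [hat_eq]; ext ⟨y, k⟩; simp

theorem atSite_singleton_product (x : ℤ) (μ : Finset (Fin 3)) : atSite ({x} ×ˢ μ) x = μ := by
  ext k; simp [mem_atSite]

theorem twoVPSum_zero_pair (ok : Finset (ℤ × Fin 3) → Prop) (x y : ℤ) (i j a : Fin 3) :
    twoVPSum p f ok 0 {(x, i), (y, j)} (hat a) =
      if y - x = 0 ∧ ({i, j} : Finset (Fin 3)) = hat a then 1 else 0 := by
  suffices h : (∃ z : ℤ, ({(x, i), (y, j)} : Finset (ℤ × Fin 3)) = {z} ×ˢ hat a) ↔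
      (y - x = 0 ∧ ({i, j} : Finset (Fin 3)) = hat a) by
    simp only [twoVPSum, h]
  constructor
  · rintro ⟨z, hz⟩
    have hx : (x, i) ∈ ({z} ×ˢ hat a : Finset (ℤ × Fin 3)) := hz ▸ by simp
    have hy : (y, j) ∈ ({z} ×ˢ hat a : Finset (ℤ × Fin 3)) := hz ▸ by simp
    simp only [Finset.mem_product, Finset.mem_singleton] at hx hy
    obtain ⟨rfl, -⟩ := hx
    obtain ⟨rfl, -⟩ := hy
    refine ⟨sub_self _, ?_⟩
    rw [← atSite_singleton_product y (hat a), ← hz]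
    ext k; simp [mem_atSite]
  · rintro ⟨hxy, h⟩
    obtain rfl : y = x := by linarith
    refine ⟨y, ?_⟩
    rw [← h]
    ext ⟨z, k⟩; simp

/-- Of the outgoing sets of two VPs at distinct sites only those with one VP at each site have a
nonzero weight, since a VP cannot disappear at a vertex. -/
theorem twoVPSum_succ_of_ne {ok : Finset (ℤ × Fin 3) → Prop} {x y : ℤ} (hxy : x ≠ y)
    (i j : Fin 3) (hok : ok {(x, i), (y, j)}) (n : ℕ) (μ : Finset (Fin 3)) :
    twoVPSum p f ok (n + 1) {(x, i), (y, j)} μ = ∑ i', ∑ j', cvc p f {i'} {i} * cvc p f {j'} {j}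
      * twoVPSum p f ok n {(x + velocity i', i'), (y + velocity j', j')} μ := by
  rw [twoVPSum, if_pos hok, sites_pair, ← Finset.sum_product', Finset.univ_product_univ]
  symm
  refine Finset.sum_of_injOn
    (fun k : Fin 3 × Fin 3 => ({(x, k.1), (y, k.2)} : Finset (ℤ × Fin 3))) ?_ ?_ ?_ ?_
  · rintro ⟨i1, j1⟩ - ⟨i2, j2⟩ - h
    simp only at h
    have h1 := atSite_pair_left hxy i1 j1
    have h2 := atSite_pair_right hxy i1 j1
    rw [h, atSite_pair_left hxy, Finset.singleton_inj] at h1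
    rw [h, atSite_pair_right hxy, Finset.singleton_inj] at h2
    rw [h1, h2]
  · rintro ⟨i1, j1⟩ -
    simp only [Finset.mem_coe, Finset.mem_powersetCard]
    refine ⟨?_, Finset.card_pair (by simp [hxy])⟩
    intro z hz
    simp only [Finset.mem_insert, Finset.mem_singleton] at hz
    rcases hz with rfl | rfl <;> simp
  · intro α hα hα'
    rw [Finset.mem_powersetCard] at hα
    rw [Finset.prod_pair hxy, atSite_pair_left hxy, atSite_pair_right hxy]
    rcases Finset.eq_empty_or_nonempty (atSite α x) with hx | ⟨i1, hi⟩
    · simp [hx, cvc_empty_single]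
    rcases Finset.eq_empty_or_nonempty (atSite α y) with hy | ⟨j1, hj⟩
    · simp [hy, cvc_empty_single]
    refine absurd ⟨(i1, j1), by simp, ?_⟩ hα'
    refine Finset.eq_of_subset_of_card_le ?_ ?_
    · intro z hz
      simp only [Finset.mem_insert, Finset.mem_singleton] at hz
      rcases hz with rfl | rfl
      · exact mem_atSite.1 hi
      · exact mem_atSite.1 hj
    · rw [hα.2, Finset.card_pair (by simp [hxy])]
  · rintro ⟨i1, j1⟩ -
    simp only [Finset.prod_pair hxy, atSite_pair_left hxy, atSite_pair_right hxy, advect_pair]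

/-- At a single site the outgoing sets of two VPs are the pairs `hat a`. -/
theorem twoVPSum_succ_of_eq {ok : Finset (ℤ × Fin 3) → Prop} (x : ℤ) {i j : Fin 3}
    (hok : ok {(x, i), (x, j)}) (n : ℕ) (μ : Finset (Fin 3)) :
    twoVPSum p f ok (n + 1) {(x, i), (x, j)} μ = ∑ a, cvc p f (hat a) {i, j}
      * twoVPSum p f ok n
          {(x + velocity (a + 1), a + 1), (x + velocity (a + 2), a + 2)} μ := by
  have hsite : atSite {(x, i), (x, j)} x = {i, j} := by ext k; simp [mem_atSite]
  have hps : (({x} : Finset ℤ) ×ˢ (univ : Finset (Fin 3))).powersetCard 2 =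
      univ.image fun a => ({x} ×ˢ hat a : Finset (ℤ × Fin 3)) := by
    have hpair : ∀ s : Finset (Fin 3), s.card = 2 → ∃ a, hat a = s := by decide
    have hhat : ∀ a : Fin 3, (hat a).card = 2 := by decide
    ext α
    simp only [Finset.mem_powersetCard, Finset.mem_image, Finset.mem_univ, true_and]
    constructor
    · rintro ⟨hα, hcard⟩
      have e : α = {x} ×ˢ atSite α x := by
        ext ⟨y, k⟩
        simp only [Finset.mem_product, Finset.mem_singleton, mem_atSite]
        constructor
        · intro h
          have := hα h
          simp only [Finset.mem_product, Finset.mem_singleton] at this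
          exact ⟨this.1, this.1 ▸ h⟩
        · rintro ⟨rfl, h⟩
          exact h
      rw [e, Finset.card_product, Finset.card_singleton, one_mul] at hcard
      obtain ⟨a, ha⟩ := hpair _ hcard
      exact ⟨a, by rw [ha, ← e]⟩
    · rintro ⟨a, rfl⟩
      exact ⟨Finset.product_subset_product_right (Finset.subset_univ _), by simp [hhat]⟩
  rw [twoVPSum, if_pos hok, sites_pair, Finset.pair_eq_singleton, hps, Finset.sum_image]
  · refine Finset.sum_congr rfl fun a _ => ?_
    rw [Finset.prod_singleton, atSite_singleton_product, hsite, singleton_product_hat, advect_pair]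
  · intro a _ b _ h
    have := congrArg (fun α => atSite α x) h
    simp only [atSite_singleton_product] at this
    have hinj : ∀ a b : Fin 3, hat a = hat b → a = b := by decide
    exact hinj a b this

/-- Diagrams with two VPs depend on the positions only through their difference. -/
theorem twoVPSum_bbgky (n : ℕ) (x y : ℤ) (i j a : Fin 3) (h : x = y → i ≠ j) :
    twoVPSum p f (fun _ => True) n {(x, i), (y, j)} (hat a) =
      pairAmp p f (bbgkyContact p f) n a (y - x) i j := by
  induction n generalizing x y i j with
  | zero => rw [twoVPSum_zero_pair, pairAmp]
  | succ n ih =>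
    by_cases hxy : x = y
    · subst hxy
      rw [twoVPSum_succ_of_eq x trivial, pairAmp, if_pos (sub_self x), bbgkyContact]
      refine Finset.sum_congr rfl fun b _ => ?_
      have hb : ∀ b : Fin 3, b + 1 ≠ b + 2 := by decide
      rw [ih _ _ _ _ fun _ => hb b, add_sub_add_left_eq_sub]
    · rw [twoVPSum_succ_of_ne hxy i j trivial, pairAmp, if_neg (by omega), indepStep]
      refine Finset.sum_congr rfl fun i' _ => Finset.sum_congr rfl fun j' _ => ?_
      rw [ih]
      · congr 2
        ring
      · rintro hp rfl
        exact hxy (by linarith)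

theorem twoVPSum_stop (n : ℕ) (x y : ℤ) (i j a : Fin 3) (h : x = y → i ≠ j) :
    twoVPSum p f (fun β => (sites β).card = 2) n {(x, i), (y, j)} (hat a) =
      pairAmp p f stopContact n a (y - x) i j := by
  induction n generalizing x y i j with
  | zero => rw [twoVPSum_zero_pair, pairAmp]
  | succ n ih =>
    by_cases hxy : x = y
    · subst hxy
      rw [twoVPSum, if_neg (by simp [sites_pair]), pairAmp, if_pos (sub_self x), stopContact]
    · rw [twoVPSum_succ_of_ne hxy i j (by rw [sites_pair, Finset.card_pair hxy]), pairAmp,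
        if_neg (by omega), indepStep]
      refine Finset.sum_congr rfl fun i' _ => Finset.sum_congr rfl fun j' _ => ?_
      rw [ih]
      · congr 2
        ring
      · rintro hp rfl
        exact hxy (by linarith)

theorem add_one_ne_add_two (b : Fin 3) : b + 1 ≠ b + 2 := by
  revert b; decide

theorem bbgkyPair_apply (n : ℕ) (a b : Fin 3) : bbgkyPair p f n a b =
    pairAmp p f (bbgkyContact p f) n a (velocity (b + 2) - velocity (b + 1)) (b + 1) (b + 2) := by
  rw [bbgkyPair, Matrix.of_apply, singleton_product_hat, advect_pair,
    twoVPSum_bbgky _ _ _ _ _ _ fun _ => add_one_ne_add_two b, add_sub_add_left_eq_sub]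

theorem firstMeeting_apply (n : ℕ) (a b : Fin 3) : firstMeeting p f n a b =
    pairAmp p f stopContact n a (velocity (b + 2) - velocity (b + 1)) (b + 1) (b + 2) := by
  rw [firstMeeting, Matrix.of_apply, singleton_product_hat, advect_pair,
    twoVPSum_stop _ _ _ _ _ _ fun _ => add_one_ne_add_two b, add_sub_add_left_eq_sub]

/-! ### The diagrams of the ring approximation -/

/-- The recursion for the factor of one VP with the first vertex split off instead of the last. -/
theorem vpFactor_succ' (n : ℕ) (i k : Fin 3) (x : ℤ) :
    vpFactor p f (n + 1) i k x =
      ∑ j, cvc p f {j} {k} * vpFactor p f n i j (x - velocity k) := by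
  induction n generalizing i x with
  | zero =>
    have h : (x - velocity i = velocity k) = (x - velocity k = velocity i) :=
      propext ⟨fun h => by linarith, fun h => by linarith⟩
    simp [vpFactor, ite_and, h]
  | succ n ih =>
    have h : ∀ l, vpFactor p f (n + 1) i l (x - velocity k) =
      ∑ j, cvc p f {i} {j} * vpFactor p f n j l (x - velocity k - velocity i) := fun l => rfl
    rw [vpFactor]
    simp only [ih, h, Finset.mul_sum]
    rw [Finset.sum_comm]
    refine Finset.sum_congr rfl fun l _ => Finset.sum_congr rfl fun j _ => ?_
    rw [sub_right_comm]
    ring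

theorem vpFactor_eq_zero (n : ℕ) (i k : Fin 3) (x : ℤ)
    (hx : x ∉ Icc (-((n : ℤ) + 1)) ((n : ℤ) + 1)) : vpFactor p f n i k x = 0 := by
  have hv : ∀ i, -1 ≤ velocity i ∧ velocity i ≤ 1 := by decide
  induction n generalizing i x with
  | zero =>
    rw [vpFactor, if_neg]
    rintro ⟨-, rfl⟩
    exact hx (by simpa using hv k)
  | succ n ih =>
    rw [vpFactor]
    refine Finset.sum_eq_zero fun j _ => ?_
    rw [ih, mul_zero]
    have := hv i
    simp only [Finset.mem_Icc, not_and_or, not_le] at hx ⊢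
    push_cast at hx
    omega

/-- The weight of two independent VPs that arrive at a common site in the directions `a` and `a'`,
after they left in the directions `i` and `j` from starting points that differ by `d`. -/
def meetFactor (p f : ℝ) (n : ℕ) (a a' i j : Fin 3) (d : ℤ) : ℝ :=
  ∑' z, vpFactor p f n a i z * vpFactor p f n a' j (z - d)

theorem summable_vpFactor_mul (n : ℕ) (a i : Fin 3) (F : ℤ → ℝ) :
    Summable fun z => vpFactor p f n a i z * F z :=
  summable_of_ne_finset_zero (s := Icc (-((n : ℤ) + 1)) ((n : ℤ) + 1)) fun z hz => by
    rw [vpFactor_eq_zero n a i z hz, zero_mul]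

theorem meetFactor_succ (n : ℕ) (a a' i j : Fin 3) (d : ℤ) :
    meetFactor p f (n + 1) a a' i j d = ∑ i', ∑ j', cvc p f {i'} {i} * cvc p f {j'} {j}
      * meetFactor p f n a a' i' j' (d + velocity j - velocity i) := by
  have hs : ∀ i' j', Summable fun z => cvc p f {i'} {i} * cvc p f {j'} {j} *
      (vpFactor p f n a i' z * vpFactor p f n a' j' (z - (d + velocity j - velocity i))) :=
    fun i' j' => (summable_vpFactor_mul n a i' _).mul_left _
  simp only [meetFactor, ← tsum_mul_left]
  -- The first step moves the first VP by `velocity i`; the sum over sites is shifted accordingly.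
  rw [← (Equiv.addRight (velocity i)).tsum_eq]
  simp only [Equiv.coe_addRight, vpFactor_succ', add_sub_cancel_right]
  rw [Finset.sum_congr rfl fun i' _ => (Summable.tsum_finsetSum fun j' _ => hs i' j').symm,
    ← Summable.tsum_finsetSum fun i' _ => summable_sum fun j' _ => hs i' j']
  refine tsum_congr fun z => ?_
  rw [Finset.sum_mul_sum]
  refine Finset.sum_congr rfl fun i' _ => Finset.sum_congr rfl fun j' _ => ?_
  rw [show z + velocity i - d - velocity j = z - (d + velocity j - velocity i) by ring]
  ring

theorem meetFactor_zero (a a' i j : Fin 3) (d : ℤ) :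
    meetFactor p f 0 a a' i j d =
      if d + velocity j - velocity i = 0 ∧ a = i ∧ a' = j then 1 else 0 := by
  rw [meetFactor, tsum_eq_single (velocity i)]
  · have h : (velocity i - d = velocity j) = (d + velocity j - velocity i = 0) :=
      propext ⟨fun h => by linarith, fun h => by linarith⟩
    simp only [vpFactor, and_true, h]
    by_cases h1 : a = i <;> by_cases h2 : a' = j <;> simp [h1, h2]
  · intro z hz
    simp [vpFactor, hz]

/-- In the ring approximation the recursion that removes the first step and the factorization into
two independent VPs describe the same amplitude; the starting points, from which the VPs move to
their positions at distance `d`, differ by `d + velocity i - velocity j`. -/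
theorem pairAmp_ring (n : ℕ) (a : Fin 3) (d : ℤ) (i j : Fin 3) :
    pairAmp p f (ringContact p f) n a d i j =
      meetFactor p f n (a + 1) (a + 2) i j (d + velocity i - velocity j)
        + meetFactor p f n (a + 2) (a + 1) i j (d + velocity i - velocity j) := by
  induction n generalizing d i j with
  | zero =>
    have h1 : ∀ a i j : Fin 3, ({i, j} : Finset (Fin 3)) = hat a ↔
        (a + 1 = i ∧ a + 2 = j) ∨ (a + 2 = i ∧ a + 1 = j) := by decide
    have h2 : ¬ ((a + 1 = i ∧ a + 2 = j) ∧ (a + 2 = i ∧ a + 1 = j)) := by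
      revert a i j; decide
    rw [pairAmp, meetFactor_zero, meetFactor_zero]
    simp only [h1]
    rw [show d + velocity i - velocity j + velocity j - velocity i = d by ring]
    split_ifs <;> first | (exfalso; tauto) | norm_num
  | succ n ih =>
    have h : pairAmp p f (ringContact p f) (n + 1) a d i j =
        indepStep p f (pairAmp p f (ringContact p f) n a) d i j := by
      rw [pairAmp]
      split_ifs with hd
      · rw [hd, ringContact]
      · rfl
    rw [h, indepStep, meetFactor_succ, meetFactor_succ, ← Finset.sum_add_distrib]
    refine Finset.sum_congr rfl fun i' _ => ?_
    rw [← Finset.sum_add_distrib]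
    refine Finset.sum_congr rfl fun j' _ => ?_
    rw [ih, mul_add]
    congr 3 <;> ring

theorem ringPair_apply (n : ℕ) (a b : Fin 3) : ringPair p f n a b =
    pairAmp p f (ringContact p f) n a (velocity (b + 2) - velocity (b + 1)) (b + 1) (b + 2) := by
  rw [pairAmp_ring, show velocity (b + 2) - velocity (b + 1) + velocity (b + 1) - velocity (b + 2)
    = 0 by ring, ringPair, Matrix.of_apply, Finset.sum_add_distrib, meetFactor, meetFactor,
    tsum_eq_sum (s := Icc (-((n : ℤ) + 1)) ((n : ℤ) + 1)),
    tsum_eq_sum (s := Icc (-((n : ℤ) + 1)) ((n : ℤ) + 1))]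
  · simp only [sub_zero]
    congr 1
    exact Finset.sum_congr rfl fun x _ => mul_comm _ _
  all_goals
    intro z hz
    rw [vpFactor_eq_zero n _ _ z hz, zero_mul]

/-! ### The effective collision matrix -/

/-- A matrix invariant under all permutations of the bits, with the eigenvalue `c` on vectors of
sum zero and the eigenvalue `L` on the constant vector. -/
def IsPermInvariant (A : Matrix (Fin 3) (Fin 3) ℝ) (c L : ℝ) : Prop :=
  ∀ a b, A a b = (if a = b then c else 0) + (L - c) / 3

theorem IsPermInvariant.mul {A B : Matrix (Fin 3) (Fin 3) ℝ} {c L c' L' : ℝ}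
    (hA : IsPermInvariant A c L) (hB : IsPermInvariant B c' L') :
    IsPermInvariant (A * B) (c * c') (L * L') := by
  intro a b
  simp only [Matrix.mul_apply, hA a _, hB _ b, add_mul, mul_add, Finset.sum_add_distrib, ite_mul,
    mul_ite, zero_mul, mul_zero, Finset.sum_ite_eq, Finset.sum_ite_eq', Finset.mem_univ, if_true,
    Finset.sum_const, Finset.card_univ, Fintype.card_fin, nsmul_eq_mul]
  split_ifs <;> push_cast <;> ring

theorem IsPermInvariant.pow {A : Matrix (Fin 3) (Fin 3) ℝ} {c L : ℝ}
    (hA : IsPermInvariant A c L) (n : ℕ) : IsPermInvariant (A ^ n) (c ^ n) (L ^ n) := by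
  induction n with
  | zero => intro a b; simp [Matrix.one_apply]
  | succ n ih =>
    simp only [pow_succ]
    exact ih.mul hA

theorem isPermInvariant_ringU : IsPermInvariant (ringU p f)
    ((1 - 2 * (f * p)) * (1 - 3 * (f * p)))
    ((1 - 2 * (f * p)) * (1 - 3 * (f * p)) + 3 * (f * p * (1 - f * p))) := by
  intro a b
  rw [ringU, Matrix.of_apply]
  simp only [cvc_single_single]
  fin_cases a <;> fin_cases b <;> simp <;> ring

theorem isPermInvariant_ringT : IsPermInvariant (ringT p f)
    (f * p * (3 * (f * p) - 1)) (f * p * (2 - 3 * (f * p))) := by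
  intro a b
  rw [ringT, Matrix.of_apply]
  simp only [cvc_single_single]
  fin_cases a <;> fin_cases b <;> simp <;> ring

theorem isPermInvariant_ringTogether : IsPermInvariant (ringTogether p f)
    ((1 - 3 * (f * p)) * (1 - f * p)) (1 - 4 * (f * p) + 6 * (f * p) ^ 2) := by
  intro a b
  rw [ringTogether, Matrix.of_apply, cvc_single_single]
  split_ifs <;> ring

theorem isPermInvariant_ringSplit : IsPermInvariant (ringSplit p f)
    (2 * (f * p) * (3 * (f * p) - 1)) (2 * (f * p) * (2 - 3 * (f * p))) := by
  intro a b
  rw [ringSplit, Matrix.of_apply]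
  simp only [cvc_single_single]
  fin_cases a <;> fin_cases b <;> simp <;> ring

/-- The delayed separations form two geometric series, one for each eigenvalue of the matrix
`ringTogether`. -/
theorem hasSum_ringDelayed {g : ℝ} (hg : g = f * p) (h0 : 0 < g) (h1 : g < 1 / 2) (a b : Fin 3) :
    HasSum (fun n => ringDelayed p f n a b)
      ((if a = b then 2 * g * (3 * g - 1) * (1 - (1 - 3 * g) * (1 - g))⁻¹ * (g * (3 * g - 1))
        else 0)
        + (2 * g * (2 - 3 * g) * (1 - (1 - 4 * g + 6 * g ^ 2))⁻¹ * (g * (2 - 3 * g))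
          - 2 * g * (3 * g - 1) * (1 - (1 - 3 * g) * (1 - g))⁻¹ * (g * (3 * g - 1))) / 3) := by
  subst hg
  have hE : ∀ n, ringDelayed p f n a b = _ := fun n =>
    (isPermInvariant_ringSplit.mul (isPermInvariant_ringTogether.pow n)).mul
      isPermInvariant_ringT a b
  simp only [hE]
  have s1 := hasSum_geometric_of_abs_lt_one (r := (1 - 3 * (f * p)) * (1 - f * p))
    (by rw [abs_lt]; constructor <;> nlinarith)
  have s2 := hasSum_geometric_of_abs_lt_one (r := 1 - 4 * (f * p) + 6 * (f * p) ^ 2)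
    (by rw [abs_lt]; constructor <;> nlinarith)
  have s1' := (s1.mul_left (2 * (f * p) * (3 * (f * p) - 1))).mul_right
    (f * p * (3 * (f * p) - 1))
  have s2' := (s2.mul_left (2 * (f * p) * (2 - 3 * (f * p)))).mul_right
    (f * p * (2 - 3 * (f * p)))
  refine HasSum.add ?_ ((s2'.sub s1').div_const 3)
  by_cases h : a = b
  · simpa only [h, if_true] using s1'
  · simpa only [h, if_false] using hasSum_zero

theorem effectiveU_apply {g : ℝ} (hg : g = f * p) (h0 : 0 < g) (h1 : g < 1 / 2) (a b : Fin 3) :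
    effectiveU p f a b = (if a = b then 1 - 9 * g * ((3 * g - 2) / (3 * g - 4)) else 0)
        + 3 * g * ((3 * g - 2) / (3 * g - 4)) := by
  rw [effectiveU, Matrix.of_apply, (hasSum_ringDelayed hg h0 h1 a b).tsum_eq,
    isPermInvariant_ringU a b, ← hg]
  have hq : (4 - 3 * g) * (4 - 3 * g)⁻¹ = 1 := mul_inv_cancel₀ (by linarith)
  have e1 : 2 * g * (3 * g - 1) * (1 - (1 - 3 * g) * (1 - g))⁻¹ * (g * (3 * g - 1)) =
      2 * g * (3 * g - 1) ^ 2 * (4 - 3 * g)⁻¹ := by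
    rw [show 1 - (1 - 3 * g) * (1 - g) = g * (4 - 3 * g) by ring, mul_inv]
    linear_combination 2 * g * (3 * g - 1) ^ 2 * (4 - 3 * g)⁻¹ * mul_inv_cancel₀ h0.ne'
  have e2 : 2 * g * (2 - 3 * g) * (1 - (1 - 4 * g + 6 * g ^ 2))⁻¹ * (g * (2 - 3 * g)) =
      g * (2 - 3 * g) := by
    rw [show 1 - (1 - 4 * g + 6 * g ^ 2) = 2 * g * (2 - 3 * g) by ring,
      mul_inv_cancel₀ (mul_ne_zero (by linarith) (by linarith)), one_mul]
  have e3 : (3 * g - 2) / (3 * g - 4) = (2 - 3 * g) * (4 - 3 * g)⁻¹ := by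
    rw [← neg_sub (2 : ℝ), ← neg_sub (4 : ℝ), neg_div_neg_eq, div_eq_mul_inv]
  rw [e1, e2, e3]
  split_ifs
  · linear_combination g * (10 / 3 - 4 * g) * hq
  · linear_combination -g * (5 / 3 - 2 * g) * hq

/-! ### The shifts in the two approximations -/

/-- For the outgoing pair `hat b` the reflection that interchanges the VPs amounts to `b ↦ b.rev`,
because it exchanges the orderings `b + 1, b + 2` of the two pairs. -/
theorem pairAmp_rev_entry {contact : (ℤ → Fin 3 → Fin 3 → ℝ) → Fin 3 → Fin 3 → ℝ}
    (hr : IsReflective contact) (n : ℕ) (a b : Fin 3) :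
    pairAmp p f contact n a.rev (velocity (b.rev + 2) - velocity (b.rev + 1)) (b.rev + 1)
        (b.rev + 2) =
      pairAmp p f contact n a (velocity (b + 2) - velocity (b + 1)) (b + 1) (b + 2) := by
  have h1 : ∀ b : Fin 3, b.rev + 1 = (b + 2).rev := by decide
  have h2 : ∀ b : Fin 3, b.rev + 2 = (b + 1).rev := by decide
  rw [h1, h2, pairAmp_rev hr, velocity_rev, velocity_rev]
  congr 1
  ring

theorem sum_abs_oddAmp_stop_le_one (hg : 0 ≤ f * p) (hg' : f * p ≤ 1 / 2) (d : ℤ) (i j : Fin 3)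
    (N : ℕ) : ∑ n ∈ range N, |oddAmp p f stopContact n d i j| ≤ 1 := by
  refine le_trans (Finset.sum_le_sum fun n _ => ?_) (sum_pairAmp_stop_le_one hg hg' N d i j)
  have h (a) := pairAmp_stop_nonneg hg hg' n a d i j
  rw [Fin.sum_univ_three, oddAmp, abs_le]
  constructor <;> linarith [h 0, h 1, h 2]

theorem oddAmp_one_two (hr : IsReflective contact) (n : ℕ) :
    oddAmp p f contact n 1 1 2 = -oddAmp p f contact n 1 0 1 := oddAmp_rev hr n 1 0 1

theorem oddAmp_two_zero (hr : IsReflective contact) (n : ℕ) :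
    oddAmp p f contact n (-2) 2 0 = 0 := by
  have : oddAmp p f contact n (-2) 2 0 = -oddAmp p f contact n (-2) 2 0 :=
    oddAmp_rev hr n (-2) 2 0
  linarith

theorem oddAmp_zero_contact (contact : (ℤ → Fin 3 → Fin 3 → ℝ) → Fin 3 → Fin 3 → ℝ) :
    oddAmp p f contact 0 0 0 1 = 1 := by
  have h2 : ({0, 1} : Finset (Fin 3)) = hat 2 := by decide
  have h0 : ({0, 1} : Finset (Fin 3)) ≠ hat 0 := by decide
  rw [oddAmp, pairAmp, pairAmp, if_pos ⟨rfl, h2⟩, if_neg fun h => h0 h.2, sub_zero]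

theorem oddAmp_bbgky_succ (n : ℕ) : oddAmp p f (bbgkyContact p f) (n + 1) 0 0 1 =
    (1 - 3 * p + 3 * p * f) * oddAmp p f (bbgkyContact p f) n 1 0 1 := by
  have h : oddAmp p f (bbgkyContact p f) (n + 1) 0 0 1 = ∑ c, cvc p f (hat c) {0, 1} *
      oddAmp p f (bbgkyContact p f) n (velocity (c + 2) - velocity (c + 1)) (c + 1) (c + 2) := by
    simp only [oddAmp, pairAmp, if_true, mul_sub, Finset.sum_sub_distrib]
    rfl
  have e0 : oddAmp p f (bbgkyContact p f) n (velocity (0 + 2) - velocity (0 + 1)) (0 + 1) (0 + 2)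
    = _ := oddAmp_one_two (isReflective_bbgky) n
  have e1 : oddAmp p f (bbgkyContact p f) n (velocity (1 + 2) - velocity (1 + 1)) (1 + 1) (1 + 2)
    = _ := oddAmp_two_zero (isReflective_bbgky) n
  have e2 : oddAmp p f (bbgkyContact p f) n (velocity (2 + 2) - velocity (2 + 1)) (2 + 1) (2 + 2)
    = oddAmp p f (bbgkyContact p f) n 1 0 1 := rfl
  have h2 : ({0, 1} : Finset (Fin 3)) = hat 2 := by decide
  rw [h, Fin.sum_univ_three, e0, e1, e2, h2]
  simp only [cvc_hat_hat]
  simp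
  ring

/-- One step of two independent VPs that start at a common site, contracted with `q2`. -/
theorem oddAmp_ring_succ (n : ℕ) (i j : Fin 3) :
    oddAmp p f (ringContact p f) (n + 1) 0 i j =
      (cvc p f {0} {i} * cvc p f {1} {j} + cvc p f {1} {i} * cvc p f {0} {j}
        - cvc p f {1} {i} * cvc p f {2} {j} - cvc p f {2} {i} * cvc p f {1} {j})
          * oddAmp p f (ringContact p f) n 1 0 1
      + (cvc p f {2} {i} * cvc p f {2} {j} - cvc p f {0} {i} * cvc p f {0} {j})
          * oddAmp p f (ringContact p f) n 0 2 2 := by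
  have h : oddAmp p f (ringContact p f) (n + 1) 0 i j =
      ∑ i', ∑ j', cvc p f {i'} {i} * cvc p f {j'} {j} *
        oddAmp p f (ringContact p f) n (0 + velocity j' - velocity i') i' j' := by
    simp only [oddAmp, pairAmp, if_true, mul_sub, Finset.sum_sub_distrib]
    rfl
  have hr := isReflective_ring (p := p) (f := f)
  have hs := isSymmetric_ring (p := p) (f := f)
  have e00 : oddAmp p f (ringContact p f) n (0 + velocity 0 - velocity 0) 0 0
    = -oddAmp p f (ringContact p f) n 0 2 2 := oddAmp_rev hr n 0 2 2
  have e01 : oddAmp p f (ringContact p f) n (0 + velocity 1 - velocity 0) 0 1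
    = oddAmp p f (ringContact p f) n 1 0 1 := rfl
  have e02 : oddAmp p f (ringContact p f) n (0 + velocity 2 - velocity 0) 0 2 = 0 :=
    (oddAmp_swap hs n (-2) 2 0).trans (oddAmp_two_zero hr n)
  have e10 : oddAmp p f (ringContact p f) n (0 + velocity 0 - velocity 1) 1 0
    = oddAmp p f (ringContact p f) n 1 0 1 := oddAmp_swap hs n 1 0 1
  have e11 : oddAmp p f (ringContact p f) n (0 + velocity 1 - velocity 1) 1 1 = 0 := by
    have : oddAmp p f (ringContact p f) n (0 + velocity 1 - velocity 1) 1 1 =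
      -oddAmp p f (ringContact p f) n (0 + velocity 1 - velocity 1) 1 1 := oddAmp_rev hr n 0 1 1
    linarith
  have e12 : oddAmp p f (ringContact p f) n (0 + velocity 2 - velocity 1) 1 2
    = -oddAmp p f (ringContact p f) n 1 0 1 := oddAmp_one_two hr n
  have e20 : oddAmp p f (ringContact p f) n (0 + velocity 0 - velocity 2) 2 0 = 0 :=
    oddAmp_two_zero hr n
  have e21 : oddAmp p f (ringContact p f) n (0 + velocity 1 - velocity 2) 2 1
    = -oddAmp p f (ringContact p f) n 1 0 1 :=
    (oddAmp_swap hs n 1 1 2).trans (oddAmp_one_two hr n)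
  have e22 : oddAmp p f (ringContact p f) n (0 + velocity 2 - velocity 2) 2 2
    = oddAmp p f (ringContact p f) n 0 2 2 := rfl
  rw [h]
  simp only [Fin.sum_univ_three, e00, e01, e02, e10, e11, e12, e20, e21, e22]
  ring

/-- In the 2-particle BBGKY approximation a meeting has the weight `v`, the eigenvalue of the
two-to-two vertex. -/
theorem hasSum_oddAmp_bbgky (hp : 0 < p) (hp' : p ≤ 1 / 2) (hf : 0 < f) (hf' : f < 1) {l : ℝ}
    (hl : HasSum (fun n => oddAmp p f stopContact n 1 0 1) l) :
    HasSum (fun n => oddAmp p f (bbgkyContact p f) n 1 0 1)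
      (l / (1 - l * (1 - 3 * p + 3 * p * f))) := by
  have hg : 0 < f * p := by positivity
  have hg' : f * p ≤ 1 / 2 := by nlinarith
  have := hasSum_of_renewal (z := fun n => oddAmp p f (bbgkyContact p f) n 0 0 1)
    (x := fun _ => 0) (u := 1 - 3 * p + 3 * p * f) (t := 0) (s := 0) (θ := 0)
    hl (sum_abs_oddAmp_stop_le_one hg.le hg' 1 0 1)
    (fun n => oddAmp_renewal isReflective_bbgky isSymmetric_bbgky n one_ne_zero 0 1)
    (oddAmp_zero_contact _) (fun n => by rw [oddAmp_bbgky_succ]; ring) rfl (fun n => by ring)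
    (by simp) (by
      rw [abs_zero, zero_mul, add_zero, abs_lt]
      constructor <;> nlinarith)
  simpa using this

/-- In the ring approximation a meeting has the weight `w`: the VPs separate at the same vertex, or
leave in a common direction and separate later. -/
theorem hasSum_oddAmp_ring {g : ℝ} (hg : g = f * p) (h0 : 0 < g) (h1 : g < 1 / 2) {l : ℝ}
    (hl : HasSum (fun n => oddAmp p f stopContact n 1 0 1) l) :
    HasSum (fun n => oddAmp p f (ringContact p f) n 1 0 1)
      (l / (1 - l * (1 - 9 * g * ((3 * g - 2) / (3 * g - 4))))) := by
  have hw : (1 - 2 * g) * (1 - 3 * g) + g * (3 * g - 1) * (2 * g * (3 * g - 1)) /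
      (1 - (1 - 3 * g) * (1 - g)) = 1 - 9 * g * ((3 * g - 2) / (3 * g - 4)) := by
    have hq : (4 - 3 * g) * (4 - 3 * g)⁻¹ = 1 := mul_inv_cancel₀ (by linarith)
    have e1 : g * (3 * g - 1) * (2 * g * (3 * g - 1)) / (1 - (1 - 3 * g) * (1 - g)) =
        2 * g * (3 * g - 1) ^ 2 * (4 - 3 * g)⁻¹ := by
      rw [show 1 - (1 - 3 * g) * (1 - g) = g * (4 - 3 * g) by ring, div_eq_mul_inv, mul_inv]
      linear_combination 2 * g * (3 * g - 1) ^ 2 * (4 - 3 * g)⁻¹ * mul_inv_cancel₀ h0.ne'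
    have e3 : (3 * g - 2) / (3 * g - 4) = (2 - 3 * g) * (4 - 3 * g)⁻¹ := by
      rw [← neg_sub (2 : ℝ), ← neg_sub (4 : ℝ), neg_div_neg_eq, div_eq_mul_inv]
    rw [e1, e3]
    linear_combination g * (5 - 6 * g) * hq
  have hθ : |(1 - 3 * g) * (1 - g)| < 1 := by
    rw [abs_lt]; constructor <;> nlinarith
  have hu : |(1 - 2 * g) * (1 - 3 * g)| + |g * (3 * g - 1)| *
      (|2 * g * (3 * g - 1)| / (1 - |(1 - 3 * g) * (1 - g)|)) < 1 := by
    rw [← mul_div_assoc, ← abs_mul, show g * (3 * g - 1) * (2 * g * (3 * g - 1)) =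
      2 * (g * (3 * g - 1)) ^ 2 by ring,
      abs_of_nonneg (show 0 ≤ 2 * (g * (3 * g - 1)) ^ 2 by positivity)]
    rcases le_total (3 * g) 1 with h | h
    · rw [abs_of_nonneg (show 0 ≤ (1 - 2 * g) * (1 - 3 * g) from
          mul_nonneg (by linarith) (by linarith)),
        abs_of_nonneg (show 0 ≤ (1 - 3 * g) * (1 - g) from mul_nonneg (by linarith) (by linarith)),
        show 2 * (g * (3 * g - 1)) ^ 2 = g * (3 * g - 1) * (2 * g * (3 * g - 1)) by ring, hw]
      have : 0 < (3 * g - 2) / (3 * g - 4) := div_pos_of_neg_of_neg (by linarith) (by linarith)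
      have := mul_pos h0 this
      linarith
    · rw [abs_of_nonpos (show (1 - 2 * g) * (1 - 3 * g) ≤ 0 from
          mul_nonpos_of_nonneg_of_nonpos (by linarith) (by linarith)),
        abs_of_nonpos (show (1 - 3 * g) * (1 - g) ≤ 0 from
          mul_nonpos_of_nonpos_of_nonneg (by linarith) (by linarith))]
      -- The denominator `2 - 4 g + 3 g ^ 2` has its minimum `2 / 3` at `g = 2 / 3`.
      have hd : 2 / 3 ≤ 1 - -((1 - 3 * g) * (1 - g)) := by nlinarith [sq_nonneg (g - 2 / 3)]
      have hn : 2 * (g * (3 * g - 1)) ^ 2 ≤ 1 / 8 := by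
        have h2 : g * (3 * g - 1) ≤ 1 / 4 := by nlinarith
        have h3 : 0 ≤ g * (3 * g - 1) := mul_nonneg h0.le (by linarith)
        nlinarith
      have hq : 2 * (g * (3 * g - 1)) ^ 2 / (1 - -((1 - 3 * g) * (1 - g))) ≤ 3 / 16 := by
        rw [div_le_iff₀ (by linarith)]
        linarith
      nlinarith
  rw [← hw]
  refine hasSum_of_renewal (z := fun n => oddAmp p f (ringContact p f) n 0 0 1)
    (x := fun n => oddAmp p f (ringContact p f) n 0 2 2)
    hl (sum_abs_oddAmp_stop_le_one (hg ▸ h0.le) (hg ▸ h1.le) 1 0 1)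
    (fun n => oddAmp_renewal isReflective_ring isSymmetric_ring n one_ne_zero 0 1)
    (oddAmp_zero_contact _) (fun n => ?_) ?_ (fun n => ?_) hθ hu
  · rw [oddAmp_ring_succ]
    simp only [cvc_single_single, ← hg]
    simp
    ring
  · have h2 : ({2} : Finset (Fin 3)) ≠ hat 2 := by decide
    have h0 : ({2} : Finset (Fin 3)) ≠ hat 0 := by decide
    simp [oddAmp, pairAmp, h2, h0]
  · rw [oddAmp_ring_succ]
    simp only [cvc_single_single, ← hg]
    simp
    ring

end OneD3P

end

theorem mainTheorem7 (p f g w v : ℝ) (hp : 0 < p) (hp' : p ≤ 1 / 2) (hf : 0 < f) (hf' : f < 1)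
    (hg : g = f * p) (hw : w = 1 - 9 * g * ((3 * g - 2) / (3 * g - 4)))
    (hv : v = 1 - 3 * p + 3 * p * f) :
    -- the effective collision matrix converges, with the stated entries and eigenvalue
    (∀ a b, Summable fun n => ringDelayed p f n a b) ∧
    (∀ a b, effectiveU p f a b =
      (if a = b then 1 - 9 * g * ((3 * g - 2) / (3 * g - 4)) else 0)
        + 3 * g * ((3 * g - 2) / (3 * g - 4))) ∧
    q2 ᵥ* effectiveU p f = w • q2 ∧
    -- the two-particle collision matrix has the eigenvalue `v`
    q2 ᵥ* vertex22 p f = v • q2 ∧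
    -- the first-meeting matrix converges
    (∀ a b, Summable fun n => firstMeeting p f n a b) ∧
    ∃ l δ δ' : ℝ,
      q2 ᵥ* matrixM p f = l • q2 ∧ matrixM p f *ᵥ q2 = l • q2 ∧
      |l * w| < 1 ∧ |l * v| < 1 ∧
      -- the shift in the ring approximation is finite and has the resolvent form
      IsEigenvalueShift p f (ringPair p f) δ ∧
      δ = 9 * (p ^ 2 * f * (1 - f) * l) / (1 - l * w) ∧
      -- likewise in the two-particle BBGKY approximation
      IsEigenvalueShift p f (bbgkyPair p f) δ' ∧
      δ' = 9 * (p ^ 2 * f * (1 - f) * l) / (1 - l * v) ∧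
      -- the algebraic relation between the two shifts
      δ * (4 - 21 * p * f + 27 * p ^ 2 * f ^ 2) + 9 * p ^ 2 * f * (1 - f) * (4 - 3 * p * f) ≠ 0 ∧
      δ' * (1 - 3 * p + 3 * p * f) + 9 * p ^ 2 * f * (1 - f) ≠ 0 ∧
      δ * (4 - 3 * p * f)
          / (δ * (4 - 21 * p * f + 27 * p ^ 2 * f ^ 2)
              + 9 * p ^ 2 * f * (1 - f) * (4 - 3 * p * f))
        = δ' / (δ' * (1 - 3 * p + 3 * p * f) + 9 * p ^ 2 * f * (1 - f)) := by
  have hg0 : 0 < g := hg ▸ mul_pos hf hp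
  have hg1 : g < 1 / 2 := by rw [hg]; nlinarith
  have hU := effectiveU_apply hg hg0 hg1
  have hV : ∀ a b, vertex22 p f a b = (if a = b then 1 - 3 * p + 3 * p * f else 0) + p * (1 - f) :=
    cvc_hat_hat p f
  have hF : ∀ a b, Summable fun n => firstMeeting p f n a b := fun a b => by
    simp only [firstMeeting_apply]
    exact summable_pairAmp_stop (hg ▸ hg0.le) (hg ▸ hg1.le) _ _ _ _
  obtain ⟨l, hl⟩ : ∃ l, l = matrixM p f 2 2 - matrixM p f 0 2 := ⟨_, rfl⟩
  have hMrev : ∀ a b, matrixM p f a.rev b.rev = matrixM p f a b := fun a b => by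
    simp only [matrixM, Matrix.of_apply, firstMeeting_apply, pairAmp_rev_entry isReflective_stop]
  have hφ : HasSum (fun n => oddAmp p f stopContact n 1 0 1) l := by
    have h := (hF 2 2).hasSum.sub (hF 0 2).hasSum
    simp only [firstMeeting_apply] at h
    rw [hl]
    simp only [matrixM, Matrix.of_apply, firstMeeting_apply]
    exact h
  have hl1 : |l| ≤ 1 := by
    have hs := summable_of_sum_range_le
      (f := fun n => ‖oddAmp p f stopContact n 1 0 1‖) (fun n => norm_nonneg _)
      (sum_abs_oddAmp_stop_le_one (hg ▸ hg0.le) (hg ▸ hg1.le) 1 0 1)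
    rw [← hφ.tsum_eq]
    exact (norm_tsum_le_tsum_norm hs).trans (hs.tsum_le_of_sum_range_le
      (sum_abs_oddAmp_stop_le_one (hg ▸ hg0.le) (hg ▸ hg1.le) 1 0 1))
  have n3 : 3 * g - 4 ≠ 0 := by linarith
  have hw' : w * (4 - 3 * g) = 4 - 21 * g + 27 * g ^ 2 := by
    rw [hw, div_eq_mul_inv]
    linear_combination 9 * g * (3 * g - 2) * mul_inv_cancel₀ n3
  have hwabs : |w| < 1 := by
    rw [abs_lt]
    constructor <;> nlinarith [sq_nonneg (g - 4 / 9)]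
  have hvabs : |v| < 1 := by
    rw [hv, abs_lt]
    constructor <;> nlinarith
  have hlw : |l * w| < 1 := by
    rw [abs_mul]
    exact lt_of_le_of_lt (mul_le_of_le_one_left (abs_nonneg _) hl1) hwabs
  have hlv : |l * v| < 1 := by
    rw [abs_mul]
    exact lt_of_le_of_lt (mul_le_of_le_one_left (abs_nonneg _) hl1) hvabs
  have hR := hasSum_oddAmp_ring hg hg0 hg1 hφ
  have hB := hasSum_oddAmp_bbgky hp hp' hf hf' hφ
  rw [← hw] at hR
  rw [← hv] at hB
  have dw : 1 - l * w ≠ 0 := by linarith [le_abs_self (l * w)]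
  have dv : 1 - l * v ≠ 0 := by linarith [le_abs_self (l * v)]
  have hK : 9 * p ^ 2 * f * (1 - f) ≠ 0 := by
    have : 0 < 1 - f := by linarith
    positivity
  have h4 : 4 - 3 * g ≠ 0 := by linarith
  refine ⟨fun a b => (hasSum_ringDelayed hg hg0 hg1 a b).summable, hU,
    hw ▸ vecMul_q2_of_entries hU, hv ▸ vecMul_q2_of_entries hV, hF, l, _, _,
    hl ▸ vecMul_q2_of_rev hMrev, hl ▸ mulVec_q2_of_rev hMrev, hlw, hlv,
    isEigenvalueShift_of_hasSum (fun n a b => by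
      rw [ringPair_apply, ringPair_apply, pairAmp_rev_entry isReflective_ring])
      (y := l / (1 - l * w)) (by simp only [ringPair_apply]; exact hR), by ring,
    isEigenvalueShift_of_hasSum (fun n a b => by
      rw [bbgkyPair_apply, bbgkyPair_apply, pairAmp_rev_entry isReflective_bbgky])
      (y := l / (1 - l * v)) (by simp only [bbgkyPair_apply]; exact hB), by ring, ?_⟩
  have e1 : 4 - 21 * p * f + 27 * p ^ 2 * f ^ 2 = w * (4 - 3 * g) := by rw [hw', hg]; ring
  have e2 : 4 - 3 * p * f = 4 - 3 * g := by rw [hg]; ring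
  rw [e1, e2, ← hv]
  generalize 9 * p ^ 2 * f * (1 - f) = K at hK ⊢
  -- Both denominators are the outer factor `K` times the sum of the geometric series.
  have d1 : K * (l / (1 - l * w)) * (w * (4 - 3 * g)) + K * (4 - 3 * g) =
      K * (4 - 3 * g) / (1 - l * w) := by
    field_simp
    ring
  have d2 : K * (l / (1 - l * v)) * v + K = K / (1 - l * v) := by
    field_simp
    ring
  rw [d1, d2]
  refine ⟨div_ne_zero (mul_ne_zero hK h4) dw, div_ne_zero hK dv, ?_⟩
  field_simp
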